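/- Let $D\subset\mathbb C^n$ be a bounded domain (non-empty, open, connected). For $z\in D$, $X\in\mathbb C^n$ let $\kappa_D(z;X)=\inf\{|\alpha| : \exists\,\varphi:\mathbb D\to D \text{ holomorphic},\ \varphi(0)=z,\ \alpha\varphi'(0)=X\}$ be the Kobayashi--Royden metric, and let $k_D(x,y)=\inf_\gamma\int_0^1\kappa_D(\gamma(t);\gamma'(t))\,dt$ be the Kobayashi distance, the infimum being over all piecewise $\mathcal C^1$ curves $\gamma:[0,1]\to D$ with $\gamma(0)=x$, $\gamma(1)=y$. Assume that $D$ is complete hyperbolic, i.e. that $k_D$ is a complete distance on $D$. A geodesic is a map $\sigma:I\to D$ on an interval $I\subset\mathbb R$ with $k_D(\sigma(s),\sigma(t))=|s-t|$ for all $s,t\in I$; it is a geodesic ray if $I=[0,\infty)$ and a geodesic line if $I=\mathbb R$. Assume that $(D,k_D)$ is Gromov hyperbolic, i.e. that for some $\delta$ every side of every geodesic triangle of $(D,k_D)$ lies in the $\delta$-neighbourhood of the union of the other two sides. We say that $D$ has the visibility property if for all $p\neq q$ in $\partial D$ there exist neighbourhoods $U$ of $p$ and $V$ of $q$ in $\mathbb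 C^n$ with $\overline U\cap\overline V=\emptyset$ and a compact set $K\subset D$ such that every geodesic $\gamma:[0,L]\to D$ with $\gamma(0)\in U$ and $\gamma(L)\in V$ satisfies $\gamma([0,L])\cap K\neq\emptyset$. A geodesic loop in $\overline D$ is a geodesic line which has the same cluster set in $\overline D$ at $+\infty$ and at $-\infty$. Fix $z_0\in D$. The Gromov boundary $\partial_G D$ is the set of geodesic rays $\gamma$ with $\gamma(0)=z_0$ modulo the equivalence $\gamma\sim\eta \iff \sup_{t\ge 0}k_D(\gamma(t),\eta(t))<\infty$. The Gromov compactification is $\overline D^G=D\sqcup\partial_G D$ with the following topology. A sequence $(z_k)$ in $D$ converges to $\sigma\in\partial_G D$ if, for all geodesics $\gamma_k:[0,R_k]\to D$ from $z_0$ to $z_k$, every subsequence of $(\gamma_k)$ has a subsequence which converges uniformly on compacta to a geodesic ray in the class $\sigma$ (along it $R_k\to\infty$). A sequence $(\sigma_k)$ in $\partial_G D$ converges to $\sigma\in\partial_G D$ if, for all representatives $\gamma_k\in\sigma_k$, every subsequence of $(\gamma_k)$ has a subsequence which converges uniformly on compacta to a geodesic ray in the class $\sigma$. A set $W\subset\overline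 D^G$ is open if $W\cap D$ is open in $D$ and every sequence in $D$ or in $\partial_G D$ that converges in this sense to a point of $W\cap\partial_G D$ is eventually in $W$. Then, for every $z_0\in D$: 1. $D$ has the visibility property if and only if the identity map of $D$ extends to a continuous surjective map $\Phi:\overline D^G\to\overline D$, where $\overline D$ is the Euclidean closure of $D$. 2. If $\Phi:\overline D^G\to\overline D$ is such a continuous surjective extension, then $\Phi$ is a homeomorphism if and only if there is no geodesic loop in $\overline D$. -/

import Mathlib

open Set Filter Topology MeasureTheory
open scoped ENNReal

/-- Complex Euclidean space `ℂⁿ`. -/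
abbrev CSpace (n : ℕ) : Type := EuclideanSpace ℂ (Fin n)

section Kobayashi

variable {n : ℕ}

/-- The Kobayashi-Royden pseudometric `κ_D(z; X)`: the infimum of `|α|` over all holomorphic maps
`φ` from the unit disc to `D` with `φ 0 = z` and `α φ'(0) = X`. -/
noncomputable def kobayashiRoyden (D : Set (CSpace n)) (z X : CSpace n) : ℝ≥0∞ :=
  sInf {r | ∃ (α : ℂ) (φ : ℂ → CSpace n), DifferentiableOn ℂ φ (Metric.ball 0 1) ∧
    MapsTo φ (Metric.ball 0 1) D ∧ φ 0 = z ∧ α • deriv φ 0 = X ∧ r = ‖α‖ₑ}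

/-- `γ` is piecewise `C¹` on `[0,1]`: it is continuous there, and there is a finite set `S` of
break points such that `γ` is `C¹` (up to the end points) on every closed subinterval of `[0,1]`
whose interior contains no break point. -/
def IsPiecewiseC1 (γ : ℝ → CSpace n) : Prop :=
  ContinuousOn γ (Icc 0 1) ∧ ∃ S : Finset ℝ, ∀ a b : ℝ, 0 ≤ a → b ≤ 1 →
    (∀ s ∈ S, s ∉ Ioo a b) → ContDiffOn ℝ 1 γ (Icc a b)

/-- `γ` restricted to `[0,1]` is a piecewise `C¹` curve in `D` from `x` to `y`. -/
def IsCurveJoining (D : Set (CSpace n)) (x y : CSpace n) (γ : ℝ → CSpace n) : Prop :=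
  IsPiecewiseC1 γ ∧ MapsTo γ (Icc 0 1) D ∧ γ 0 = x ∧ γ 1 = y

/-- The Kobayashi-Royden length `∫₀¹ κ_D(γ(t); γ'(t)) dt` of a curve. -/
noncomputable def kobayashiLength (D : Set (CSpace n)) (γ : ℝ → CSpace n) : ℝ≥0∞ :=
  ∫⁻ t in Icc (0 : ℝ) 1, kobayashiRoyden D (γ t) (deriv γ t)

/-- The Kobayashi pseudodistance, as an extended nonnegative number: the infimum of the lengths of
the piecewise `C¹` curves joining `x` and `y` in `D`. (It is finite if `D` is a domain.) -/
noncomputable def kobayashiEDist (D : Set (CSpace n)) (x y : CSpace n) : ℝ≥0∞ :=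
  sInf {r | ∃ γ : ℝ → CSpace n, IsCurveJoining D x y γ ∧ r = kobayashiLength D γ}

/-- The Kobayashi pseudodistance `k_D(x, y)` of a domain `D`. -/
noncomputable def kobayashiDist (D : Set (CSpace n)) (x y : CSpace n) : ℝ :=
  (kobayashiEDist D x y).toReal

/-! ### `k_D` is a pseudodistance -/

lemma kobayashiRoyden_zero {D : Set (CSpace n)} {z : CSpace n} (hz : z ∈ D) :
    kobayashiRoyden D z 0 = 0 := by
  refine le_antisymm (sInf_le ⟨0, fun _ => z, ?_, ?_, rfl, ?_, ?_⟩) bot_le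
  · exact differentiableOn_const _
  · intro _ _; exact hz
  · simp
  · simp

lemma kobayashiRoyden_smul_le (D : Set (CSpace n)) (z X : CSpace n) {c : ℝ} (hc : c ≠ 0) :
    kobayashiRoyden D z (c • X) ≤ ‖c‖ₑ * kobayashiRoyden D z X := by
  rw [kobayashiRoyden, kobayashiRoyden, sInf_eq_iInf', sInf_eq_iInf',
    ENNReal.mul_iInf_of_ne (by simpa using hc) enorm_ne_top]
  refine le_iInf ?_
  rintro ⟨r, α, φ, h1, h2, h3, h4, rfl⟩
  refine (iInf_le _ ⟨‖(c : ℂ) * α‖ₑ, (c : ℂ) * α, φ, h1, h2, h3, ?_, rfl⟩).trans ?_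
  · simp only
    rw [enorm_mul]
    refine le_of_eq ?_
    congr 1
    rw [← ofReal_norm, ← ofReal_norm, Complex.norm_real]
  · rw [mul_smul, h4]
    ext i
    simp

/-- Change of variables for the length integrand under an affine reparametrization. -/
lemma lintegral_affine_le (D : Set (CSpace n)) (γ δ : ℝ → CSpace n) {c d a b a' b' : ℝ}
    (hc : c ≠ 0) (himg : (fun t : ℝ => c * t + d) '' Ioo a b ⊆ Ioo a' b')
    (hδ : ∀ t ∈ Ioo a b, δ t = γ (c * t + d)) :
    ∫⁻ t in Ioo a b, kobayashiRoyden D (δ t) (deriv δ t) ≤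
      ∫⁻ t in Ioo a' b', kobayashiRoyden D (γ t) (deriv γ t) := by
  have hderiv : ∀ t ∈ Ioo a b, deriv δ t = c • deriv γ (c * t + d) := by
    intro t ht
    have h1 : δ =ᶠ[𝓝 t] fun s => γ (c * s + d) := by
      filter_upwards [isOpen_Ioo.mem_nhds ht] with s hs using hδ s hs
    rw [h1.deriv_eq]
    have h2 := deriv_comp_mul_left c (fun u => γ (u + d)) t
    rw [h2, deriv_comp_add_const]
  calc ∫⁻ t in Ioo a b, kobayashiRoyden D (δ t) (deriv δ t)
      ≤ ∫⁻ t in Ioo a b, ENNReal.ofReal |c| *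
          kobayashiRoyden D (γ (c * t + d)) (deriv γ (c * t + d)) := by
        refine setLIntegral_mono' measurableSet_Ioo fun t ht => ?_
        rw [hderiv t ht, hδ t ht]
        refine (kobayashiRoyden_smul_le D _ _ hc).trans (le_of_eq ?_)
        rw [← ofReal_norm, Real.norm_eq_abs]
    _ = ∫⁻ t in (fun t : ℝ => c * t + d) '' Ioo a b,
          kobayashiRoyden D (γ t) (deriv γ t) := by
        rw [lintegral_image_eq_lintegral_abs_deriv_mul measurableSet_Ioo (f' := fun _ => c)]
        · intro x _
          simpa using (((hasDerivAt_id x).const_mul c).add_const d).hasDerivWithinAt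
        · intro x _ y _ hxy
          have : c * x = c * y := by simpa using hxy
          exact mul_left_cancel₀ hc this
    _ ≤ _ := lintegral_mono_set himg

lemma kobayashiLength_eq_Ioo (D : Set (CSpace n)) (γ : ℝ → CSpace n) :
    kobayashiLength D γ = ∫⁻ t in Ioo (0 : ℝ) 1, kobayashiRoyden D (γ t) (deriv γ t) := by
  rw [kobayashiLength, restrict_Ioo_eq_restrict_Icc]

lemma kobayashiEDist_le (D : Set (CSpace n)) {x y : CSpace n} {γ : ℝ → CSpace n}
    (h : IsCurveJoining D x y γ) : kobayashiEDist D x y ≤ kobayashiLength D γ :=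
  sInf_le ⟨γ, h, rfl⟩

lemma kobayashiEDist_self {D : Set (CSpace n)} {x : CSpace n} (hx : x ∈ D) :
    kobayashiEDist D x x = 0 := by
  refine le_antisymm ((kobayashiEDist_le D (γ := fun _ => x) ?_).trans ?_) bot_le
  · exact ⟨⟨continuousOn_const, ∅, fun _ _ _ _ _ => contDiffOn_const⟩, fun _ _ => hx, rfl, rfl⟩
  · simp [kobayashiLength, kobayashiRoyden_zero hx]

lemma kobayashiEDist_comm_le (D : Set (CSpace n)) (x y : CSpace n) :
    kobayashiEDist D x y ≤ kobayashiEDist D y x := by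
  refine le_sInf ?_
  rintro r ⟨γ, ⟨⟨hcont, S, hS⟩, hD, h0, h1⟩, rfl⟩
  have hmaps : ∀ a b : ℝ, MapsTo (fun t : ℝ => 1 - t) (Icc a b) (Icc (1 - b) (1 - a)) :=
    fun a b t ht => ⟨by linarith [ht.2], by linarith [ht.1]⟩
  have hmaps01 : MapsTo (fun t : ℝ => 1 - t) (Icc 0 1) (Icc 0 1) :=
    fun t ht => ⟨by linarith [ht.2], by linarith [ht.1]⟩
  refine (kobayashiEDist_le D (γ := fun t => γ (1 - t)) ?_).trans ?_
  · refine ⟨⟨?_, S.image (fun s => 1 - s), ?_⟩, ?_, by simpa using h1, by simpa using h0⟩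
    · exact hcont.comp (by fun_prop) hmaps01
    · intro a b ha hb hab
      refine (hS (1 - b) (1 - a) (by linarith) (by linarith) ?_).comp
        (by fun_prop) (hmaps a b)
      intro s hs hs'
      exact hab (1 - s) (Finset.mem_image_of_mem _ hs)
        ⟨by linarith [hs'.2], by linarith [hs'.1]⟩
    · exact hD.comp hmaps01
  · rw [kobayashiLength_eq_Ioo, kobayashiLength_eq_Ioo]
    refine lintegral_affine_le D γ _ (c := -1) (d := 1) (by norm_num) ?_ ?_
    · rintro _ ⟨t, ht, rfl⟩
      exact ⟨by simp only; linarith [ht.2], by simp only; linarith [ht.1]⟩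
    · intro t _
      congr 1
      ring

lemma kobayashiEDist_comm (D : Set (CSpace n)) (x y : CSpace n) :
    kobayashiEDist D x y = kobayashiEDist D y x :=
  le_antisymm (kobayashiEDist_comm_le D x y) (kobayashiEDist_comm_le D y x)

lemma kobayashiEDist_triangle (D : Set (CSpace n)) (x y z : CSpace n) :
    kobayashiEDist D x z ≤ kobayashiEDist D x y + kobayashiEDist D y z := by
  have key : ∀ γ₁ γ₂ : ℝ → CSpace n, IsCurveJoining D x y γ₁ → IsCurveJoining D y z γ₂ →
      kobayashiEDist D x z ≤ kobayashiLength D γ₁ + kobayashiLength D γ₂ := by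
    rintro γ₁ γ₂ ⟨⟨hc₁, S₁, hS₁⟩, hD₁, h0₁, h1₁⟩ ⟨⟨hc₂, S₂, hS₂⟩, hD₂, h0₂, h1₂⟩
    set γ : ℝ → CSpace n := fun t => if t ≤ 1 / 2 then γ₁ (2 * t) else γ₂ (2 * t - 1) with hγ
    have hle : ∀ t : ℝ, t ≤ 1 / 2 → γ t = γ₁ (2 * t) := fun t ht => by simp only [hγ, if_pos ht]
    have hge : ∀ t : ℝ, 1 / 2 ≤ t → γ t = γ₂ (2 * t - 1) := by
      intro t ht
      rcases ht.eq_or_lt with rfl | ht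
      · rw [hle _ le_rfl]; norm_num [h1₁, h0₂]
      · simp only [hγ, if_neg (not_le.2 ht)]
    have hm₁ : ∀ a b : ℝ, MapsTo (fun t : ℝ => 2 * t) (Icc a b) (Icc (2 * a) (2 * b)) :=
      fun a b t ht => ⟨by simp only; linarith [ht.1], by simp only; linarith [ht.2]⟩
    have hm₂ : ∀ a b : ℝ,
        MapsTo (fun t : ℝ => 2 * t - 1) (Icc a b) (Icc (2 * a - 1) (2 * b - 1)) :=
      fun a b t ht => ⟨by simp only; linarith [ht.1], by simp only; linarith [ht.2]⟩
    refine (kobayashiEDist_le D (γ := γ) ⟨⟨?_, ?_⟩, ?_, ?_, ?_⟩).trans ?_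
    · have e1 : ContinuousOn γ (Icc 0 (1 / 2)) := by
        refine ContinuousOn.congr (hc₁.comp (f := fun t : ℝ => 2 * t) (by fun_prop) ?_)
          fun t ht => hle t ht.2
        convert hm₁ 0 (1 / 2) using 2 <;> norm_num
      have e2 : ContinuousOn γ (Icc (1 / 2) 1) := by
        refine ContinuousOn.congr (hc₂.comp (f := fun t : ℝ => 2 * t - 1) (by fun_prop) ?_)
          fun t ht => hge t ht.1
        convert hm₂ (1 / 2) 1 using 2 <;> norm_num
      rw [← Icc_union_Icc_eq_Icc (show (0 : ℝ) ≤ 1 / 2 by norm_num)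
        (show (1 / 2 : ℝ) ≤ 1 by norm_num)]
      exact e1.union_of_isClosed e2 isClosed_Icc isClosed_Icc
    · refine ⟨insert (1 / 2) (S₁.image (fun s => s / 2) ∪ S₂.image (fun s => (s + 1) / 2)), ?_⟩
      intro a b ha hb hab
      have hhalf := hab (1 / 2) (by simp)
      by_cases hb' : b ≤ 1 / 2
      · refine ContDiffOn.congr ((hS₁ (2 * a) (2 * b) (by linarith) (by linarith) ?_).comp
          (f := fun t : ℝ => 2 * t) (by fun_prop) (hm₁ a b)) fun t ht => hle t (ht.2.trans hb')
        intro s hs hs'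
        exact hab (s / 2) (by simp only [Finset.mem_insert, Finset.mem_union, Finset.mem_image]
                              exact Or.inr (Or.inl ⟨s, hs, rfl⟩))
          ⟨by linarith [hs'.1], by linarith [hs'.2]⟩
      · have ha' : 1 / 2 ≤ a := by
          by_contra hcon
          exact hhalf ⟨not_le.1 hcon, not_le.1 hb'⟩
        refine ContDiffOn.congr ((hS₂ (2 * a - 1) (2 * b - 1) (by linarith) (by linarith) ?_).comp
          (f := fun t : ℝ => 2 * t - 1) (by fun_prop) (hm₂ a b))
          fun t ht => hge t (ha'.trans ht.1)
        intro s hs hs'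
        exact hab ((s + 1) / 2)
          (by simp only [Finset.mem_insert, Finset.mem_union, Finset.mem_image]
              exact Or.inr (Or.inr ⟨s, hs, rfl⟩))
          ⟨by linarith [hs'.1], by linarith [hs'.2]⟩
    · intro t ht
      rcases le_total t (1 / 2) with h | h
      · rw [hle t h]; exact hD₁ ⟨by linarith [ht.1], by linarith⟩
      · rw [hge t h]; exact hD₂ ⟨by linarith, by linarith [ht.2]⟩
    · rw [hle 0 (by norm_num)]; simpa using h0₁
    · rw [hge 1 (by norm_num)]; norm_num [h1₂]
    · rw [kobayashiLength_eq_Ioo D γ, kobayashiLength_eq_Ioo D γ₁, kobayashiLength_eq_Ioo D γ₂]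
      rw [show ∫⁻ t in Ioo (0 : ℝ) 1, kobayashiRoyden D (γ t) (deriv γ t) =
        ∫⁻ t in Ioc (0 : ℝ) (1 / 2) ∪ Ioo (1 / 2) 1, kobayashiRoyden D (γ t) (deriv γ t) by
        rw [Ioc_union_Ioo_eq_Ioo (show (0 : ℝ) ≤ 1 / 2 by norm_num)
        (show (1 / 2 : ℝ) < 1 by norm_num)]]
      refine (lintegral_union_le _ _ _).trans (add_le_add ?_ ?_)
      · rw [← restrict_Ioo_eq_restrict_Ioc]
        refine lintegral_affine_le D γ₁ γ (c := 2) (d := 0) (by norm_num) ?_ ?_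
        · rintro _ ⟨t, ht, rfl⟩
          exact ⟨by simp only; linarith [ht.1], by simp only; linarith [ht.2]⟩
        · intro t ht
          rw [hle t ht.2.le, add_zero]
      · refine lintegral_affine_le D γ₂ γ (c := 2) (d := -1) (by norm_num) ?_ ?_
        · rintro _ ⟨t, ht, rfl⟩
          exact ⟨by simp only; linarith [ht.1], by simp only; linarith [ht.2]⟩
        · intro t ht
          rw [hge t ht.1.le, sub_eq_add_neg]
  conv_rhs => rw [kobayashiEDist, kobayashiEDist, sInf_eq_iInf', sInf_eq_iInf']
  refine ENNReal.le_iInf_add_iInf ?_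
  rintro ⟨_, γ₁, h₁, rfl⟩ ⟨_, γ₂, h₂, rfl⟩
  exact key γ₁ γ₂ h₁ h₂

/-! ### Complete hyperbolicity, geodesics, Gromov hyperbolicity -/

/-- Kobayashi hyperbolicity: `k_D` separates the points of `D`. -/
def IsKobayashiHyperbolic (D : Set (CSpace n)) : Prop :=
  ∀ x ∈ D, ∀ y ∈ D, kobayashiDist D x y = 0 → x = y

/-- Complete hyperbolicity: `k_D` is a distance on `D`, and every Cauchy sequence for `k_D`
converges for `k_D` to a point of `D`. -/
def IsCompleteHyperbolic (D : Set (CSpace n)) : Prop :=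
  IsKobayashiHyperbolic D ∧
    ∀ u : ℕ → CSpace n, (∀ i, u i ∈ D) →
      (∀ ε : ℝ, 0 < ε → ∃ N : ℕ, ∀ i ≥ N, ∀ j ≥ N, kobayashiDist D (u i) (u j) < ε) →
      ∃ x ∈ D, Tendsto (fun i => kobayashiDist D (u i) x) atTop (𝓝 0)

/-- `σ`, restricted to the interval `I`, is a geodesic for `k_D`. Only the values of `σ` on `I`
matter. -/
def IsGeodesicOn (D : Set (CSpace n)) (I : Set ℝ) (σ : ℝ → CSpace n) : Prop :=
  MapsTo σ I D ∧ ∀ s ∈ I, ∀ t ∈ I, kobayashiDist D (σ s) (σ t) = |s - t|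

/-- `σ : [0, L] → D` is a geodesic joining `x` and `y`. -/
def IsGeodesicJoining (D : Set (CSpace n)) (x y : CSpace n) (L : ℝ) (σ : ℝ → CSpace n) : Prop :=
  0 ≤ L ∧ IsGeodesicOn D (Icc 0 L) σ ∧ σ 0 = x ∧ σ L = y

/-- `σ : (-∞, ∞) → D` is a geodesic line. -/
def IsGeodesicLine (D : Set (CSpace n)) (σ : ℝ → CSpace n) : Prop :=
  IsGeodesicOn D univ σ

/-- Gromov hyperbolicity of the geodesic space `(D, k_D)`: there is `δ` such that all geodesic
triangles are `δ`-slim, i.e. each side lies in the closed `δ`-neighbourhood of the union of the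
other two. (By cyclic permutation of the vertices it is enough to speak about the first side.) -/
def IsGromovHyperbolic (D : Set (CSpace n)) : Prop :=
  ∃ δ : ℝ, ∀ (x y z : CSpace n) (L₁ L₂ L₃ : ℝ) (σ₁ σ₂ σ₃ : ℝ → CSpace n),
    IsGeodesicJoining D x y L₁ σ₁ → IsGeodesicJoining D y z L₂ σ₂ →
    IsGeodesicJoining D z x L₃ σ₃ → ∀ s ∈ Icc 0 L₁,
      (∃ t ∈ Icc 0 L₂, kobayashiDist D (σ₁ s) (σ₂ t) ≤ δ) ∨
      (∃ t ∈ Icc 0 L₃, kobayashiDist D (σ₁ s) (σ₃ t) ≤ δ)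

/-! ### Visibility and geodesic loops -/

/-- The pair of boundary points `p, q` has visible geodesics. -/
def HasVisibleGeodesics (D : Set (CSpace n)) (p q : CSpace n) : Prop :=
  ∃ U ∈ 𝓝 p, ∃ V ∈ 𝓝 q, closure U ∩ closure V = ∅ ∧
    ∃ K : Set (CSpace n), IsCompact K ∧ K ⊆ D ∧
      ∀ (L : ℝ) (γ : ℝ → CSpace n), 0 ≤ L → IsGeodesicOn D (Icc 0 L) γ → γ 0 ∈ U → γ L ∈ V →
        ((γ '' Icc 0 L) ∩ K).Nonempty

/-- The visibility property: every pair of distinct points of the Euclidean boundary has visible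
geodesics. -/
def HasVisibilityProperty (D : Set (CSpace n)) : Prop :=
  ∀ p ∈ frontier D, ∀ q ∈ frontier D, p ≠ q → HasVisibleGeodesics D p q

/-- The cluster set in the Euclidean closure of `D` of a curve `γ : ℝ → D` along the filter `l`
(`atTop` for `+∞`, `atBot` for `-∞`). -/
def clusterSet (D : Set (CSpace n)) (l : Filter ℝ) (γ : ℝ → CSpace n) : Set (CSpace n) :=
  {p | p ∈ closure D ∧ MapClusterPt p l γ}

/-- A geodesic loop in `closure D`: a geodesic line with the same cluster set at `+∞` and `-∞`. -/
def IsGeodesicLoop (D : Set (CSpace n)) (γ : ℝ → CSpace n) : Prop :=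
  IsGeodesicLine D γ ∧ clusterSet D atTop γ = clusterSet D atBot γ

/-- `D` has no geodesic loops in `closure D`. -/
def HasNoGeodesicLoops (D : Set (CSpace n)) : Prop :=
  ¬ ∃ γ : ℝ → CSpace n, IsGeodesicLoop D γ

/-! ### The Gromov compactification -/

/-- The geodesic rays `γ : [0, ∞) → D` issuing from `z₀`. -/
def GeodesicRay (D : Set (CSpace n)) (z₀ : D) : Type :=
  {γ : ℝ → CSpace n // IsGeodesicOn D (Ici 0) γ ∧ γ 0 = z₀}

/-- Two rays are equivalent if `sup_{t ≥ 0} k_D(γ(t), η(t)) < ∞`. -/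
instance geodesicRaySetoid (D : Set (CSpace n)) (z₀ : D) : Setoid (GeodesicRay D z₀) where
  r γ η := ⨆ t ∈ Ici (0 : ℝ), kobayashiEDist D (γ.1 t) (η.1 t) < ⊤
  iseqv := by
    refine ⟨fun γ => ?_, fun {γ η} h => ?_, fun {γ η θ} h₁ h₂ => ?_⟩
    · refine lt_of_le_of_lt (b := 0) (iSup₂_le fun t ht => ?_) ENNReal.zero_lt_top
      exact (kobayashiEDist_self (γ.2.1.1 ht)).le
    · simpa only [kobayashiEDist_comm D (η.1 _)] using h
    · refine lt_of_le_of_lt (iSup₂_le fun t ht => ?_) (ENNReal.add_lt_top.2 ⟨h₁, h₂⟩)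
      exact (kobayashiEDist_triangle D _ (η.1 t) _).trans (add_le_add
        (le_iSup₂ (f := fun t (_ : t ∈ Ici (0 : ℝ)) => kobayashiEDist D (γ.1 t) (η.1 t)) t ht)
        (le_iSup₂ (f := fun t (_ : t ∈ Ici (0 : ℝ)) => kobayashiEDist D (η.1 t) (θ.1 t)) t ht))

/-- The Gromov boundary `∂_G D`: equivalence classes of geodesic rays from `z₀`. -/
def GromovBoundary (D : Set (CSpace n)) (z₀ : D) : Type :=
  Quotient (geodesicRaySetoid D z₀)

/-- The underlying set `D ∪ ∂_G D` of the Gromov compactification. -/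
inductive GromovCompactification (D : Set (CSpace n)) (z₀ : D) : Type
  | inner (z : D) : GromovCompactification D z₀
  | ideal (σ : GromovBoundary D z₀) : GromovCompactification D z₀

variable {D : Set (CSpace n)} {z₀ : D}

/-- Some ray in the class `σ` is the limit, uniformly on compact subsets of `[0, ∞)`, of the
curves `γ k`. -/
def LimitRayInClass (γ : ℕ → ℝ → CSpace n) (σ : GromovBoundary D z₀) : Prop :=
  ∃ η : GeodesicRay D z₀, Quotient.mk (geodesicRaySetoid D z₀) η = σ ∧
    ∀ T : ℝ, TendstoUniformlyOn γ η.1 atTop (Icc 0 T)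

/-- Convergence of a sequence of points of `D` to a point `σ` of the Gromov boundary: whenever
`γ k : [0, R k] → D` are geodesics joining `z₀` to `z k`, every subsequence of `γ` has a further
subsequence that converges uniformly on compacta (in particular its intervals of definition
exhaust `[0, ∞)`) to a geodesic ray in the class `σ`. -/
def PointsConverge (z : ℕ → D) (σ : GromovBoundary D z₀) : Prop :=
  ∀ (R : ℕ → ℝ) (γ : ℕ → ℝ → CSpace n), (∀ k, IsGeodesicJoining D z₀ (z k) (R k) (γ k)) →
    ∀ φ : ℕ → ℕ, StrictMono φ → ∃ ψ : ℕ → ℕ, StrictMono ψ ∧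
      Tendsto (fun j => R (φ (ψ j))) atTop atTop ∧
      LimitRayInClass (fun j => γ (φ (ψ j))) σ

/-- Convergence of a sequence of points `s k` of the Gromov boundary to a point `σ` of the Gromov
boundary: for all representatives `γ k` of `s k`, every subsequence of `γ` has a further
subsequence that converges uniformly on compacta to a geodesic ray in the class `σ`. -/
def ClassesConverge (s : ℕ → GromovBoundary D z₀) (σ : GromovBoundary D z₀) : Prop :=
  ∀ γ : ℕ → GeodesicRay D z₀, (∀ k, Quotient.mk (geodesicRaySetoid D z₀) (γ k) = s k) →
    ∀ φ : ℕ → ℕ, StrictMono φ → ∃ ψ : ℕ → ℕ, StrictMono ψ ∧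
      LimitRayInClass (fun j => (γ (φ (ψ j))).1) σ

/-- The topology of the Gromov compactification. It is the sequential topology determined by the
convergent sequences: a set is open iff its trace on `D` is open, and every sequence in `D`, and
every sequence in the Gromov boundary, that converges to one of its boundary points is eventually
in the set. -/
instance gromovTopology (D : Set (CSpace n)) (z₀ : D) :
    TopologicalSpace (GromovCompactification D z₀) where
  IsOpen W := IsOpen {z : D | GromovCompactification.inner z ∈ W} ∧
    ∀ σ : GromovBoundary D z₀, GromovCompactification.ideal σ ∈ W →
      (∀ z : ℕ → D, PointsConverge z σ →
        ∀ᶠ k in atTop, GromovCompactification.inner (z k) ∈ W) ∧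
      (∀ s : ℕ → GromovBoundary D z₀, ClassesConverge s σ →
        ∀ᶠ k in atTop, GromovCompactification.ideal (s k) ∈ W)
  isOpen_univ := ⟨by simp, fun _ _ => ⟨fun _ _ => by simp, fun _ _ => by simp⟩⟩
  isOpen_inter := by
    rintro W₁ W₂ ⟨h₁, h₁'⟩ ⟨h₂, h₂'⟩
    refine ⟨h₁.inter h₂, fun σ hσ => ⟨fun z hz => ?_, fun s hs => ?_⟩⟩
    · exact ((h₁' σ hσ.1).1 z hz).and ((h₂' σ hσ.2).1 z hz)
    · exact ((h₁' σ hσ.1).2 s hs).and ((h₂' σ hσ.2).2 s hs)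
  isOpen_sUnion := by
    intro 𝒲 h
    refine ⟨?_, fun σ hσ => ?_⟩
    · have : {z : D | GromovCompactification.inner (z₀ := z₀) z ∈ ⋃₀ 𝒲} =
          ⋃ W ∈ 𝒲, {z : D | GromovCompactification.inner (z₀ := z₀) z ∈ W} := by
        ext z; simp
      rw [this]
      exact isOpen_biUnion fun W hW => (h W hW).1
    · obtain ⟨W, hW, hσW⟩ := hσ
      refine ⟨fun z hz => ?_, fun s hs => ?_⟩
      · exact (((h W hW).2 σ hσW).1 z hz).mono fun k hk => ⟨W, hW, hk⟩
      · exact (((h W hW).2 σ hσW).2 s hs).mono fun k hk => ⟨W, hW, hk⟩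

/-- `Φ` is a continuous surjective extension of the identity map of `D` to a map from the Gromov
compactification onto the Euclidean closure of `D`. -/
def IsContinuousSurjectiveExtension (Φ : GromovCompactification D z₀ → closure D) : Prop :=
  Continuous Φ ∧ Function.Surjective Φ ∧
    ∀ z : D, (Φ (GromovCompactification.inner z) : CSpace n) = z

end Kobayashi

/-!
`D` with the Kobayashi distance is a length space with the Euclidean topology, so by Hopf–Rinow it
is proper and geodesic as soon as it is complete. Arzelà–Ascoli then makes long geodesics from `z₀`
subconverge to rays, and slimness of triangles says that the end points of geodesics which escape
to infinity subconverge to the same point of the Gromov boundary.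

Visibility is the statement that geodesics whose end points tend to two different points of `∂D`
cannot escape to infinity. If it holds, every ray lands at a point of `∂D` which only depends on its
class, and sending a class to that point extends the identity. Conversely, geodesics which violate
visibility escape, so their end points converge to one ideal point, on which an extension of the
identity would need two values.

Since the Gromov compactification is sequentially compact, an extension `Φ` is closed, hence it is a
homeomorphism as soon as it is injective. The two ends of a geodesic line are different ideal
points, and any two different ideal points are the ends of a geodesic line; this line is a loop if
and only if `Φ` identifies its ends.
-/

/-! ### Length spaces -/

section LengthSpaces

/-- `X` is an approximate length space: any two points are joined by paths along which, up to an
arbitrarily small error, no detour is made. Lengths only enter through sums of three consecutive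
distances, which suffices to extract geodesics. -/
def HasAlmostMinimizingPaths (X : Type*) [PseudoMetricSpace X] : Prop :=
  ∀ x y : X, ∀ ε > 0, ∃ c : Path x y, ∀ a b, a ≤ b →
    dist x (c a) + dist (c a) (c b) + dist (c b) y ≤ dist x y + ε

namespace HasAlmostMinimizingPaths

theorem exists_almost_geodesic {X : Type*} [PseudoMetricSpace X]
    (h : HasAlmostMinimizingPaths X) (x y : X) {ε : ℝ} (hε : 0 < ε) :
    ∃ f : Icc 0 (dist x y) → X, ∀ s, dist x (f s) = s ∧ dist (f s) y ≤ dist x y - s + ε ∧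
      ∀ t, |dist (f s) (f t) - dist s t| ≤ ε := by
  obtain ⟨c, hc⟩ := h x y ε hε
  have hsurj : ∀ s : Icc 0 (dist x y), ∃ τ, dist x (c τ) = s := fun s => by
    have hcont : Continuous fun τ => dist x (c τ) := by fun_prop
    have hs := intermediate_value_univ 0 1 hcont
    simp only [c.source, c.target, dist_self] at hs
    exact hs s.2
  choose τ hτ using hsurj
  have abs_le_of_le : ∀ s t : Icc 0 (dist x y), (s : ℝ) ≤ t →
      |dist (c (τ s)) (c (τ t)) - dist s t| ≤ ε := fun s t hst => by
    have htri := dist_triangle x (c (τ s)) (c (τ t))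
    rw [hτ, hτ] at htri
    have hdist : dist s t = (t : ℝ) - s := by
      rw [dist_comm, Subtype.dist_eq, Real.dist_eq, abs_of_nonneg (sub_nonneg.2 hst)]
    rw [hdist, abs_le]
    refine ⟨by linarith, ?_⟩
    rcases le_total (τ s) (τ t) with hle | hle
    · have hsum := hc _ _ hle
      have := dist_triangle x (c (τ t)) y
      rw [hτ] at hsum this
      linarith
    · have hsum := hc _ _ hle
      have := dist_triangle x (c (τ s)) y
      rw [hτ, dist_comm (c (τ t))] at hsum
      rw [hτ] at this
      linarith
  refine ⟨c ∘ τ, fun s => ⟨hτ s, ?_, fun t => ?_⟩⟩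
  · have hsum := hc _ _ (le_refl (τ s))
    rw [hτ, dist_self] at hsum
    simp only [Function.comp_apply]
    linarith
  · rcases le_total (s : ℝ) t with hst | hst
    · exact abs_le_of_le s t hst
    · rw [dist_comm s, dist_comm ((c ∘ τ) s)]
      exact abs_le_of_le t s hst

section HopfRinow

variable {X : Type*} [PseudoMetricSpace X]

lemma exists_dist_le_sub_half (h : HasAlmostMinimizingPaths X) (x y : X) {η : ℝ} (hη : 0 < η) :
    ∃ z, dist y z ≤ η ∧ dist x z ≤ max 0 (dist x y - η / 2) := by
  obtain ⟨f, hf⟩ := h.exists_almost_geodesic x y (half_pos hη)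
  have hs : max 0 (dist x y - η / 2) ∈ Icc 0 (dist x y) :=
    ⟨le_max_left _ _, max_le dist_nonneg (by linarith)⟩
  obtain ⟨hxz, hzy, -⟩ := hf ⟨_, hs⟩
  refine ⟨f ⟨_, hs⟩, ?_, hxz.le⟩
  rw [dist_comm]
  linarith [le_max_right 0 (dist x y - η / 2)]

lemma isCompact_closedBall_of_forall_lt [CompleteSpace X] (h : HasAlmostMinimizingPaths X)
    {x : X} {ρ : ℝ} (hρ : 0 < ρ) (hlt : ∀ r < ρ, IsCompact (Metric.closedBall x r)) :
    IsCompact (Metric.closedBall x ρ) := by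
  refine TotallyBounded.isCompact_of_isClosed ?_ Metric.isClosed_closedBall
  refine Metric.totallyBounded_iff.2 fun ε hε => ?_
  have hK : IsCompact (Metric.closedBall x (max 0 (ρ - ε / 4))) :=
    hlt _ (max_lt hρ (by linarith))
  obtain ⟨t, ht, hcover⟩ := Metric.totallyBounded_iff.1 hK.totallyBounded (ε / 2) (half_pos hε)
  refine ⟨t, ht, fun y hy => ?_⟩
  rw [Metric.mem_closedBall, dist_comm] at hy
  obtain ⟨z, hyz, hxz⟩ := h.exists_dist_le_sub_half x y (half_pos hε)
  have hz : z ∈ Metric.closedBall x (max 0 (ρ - ε / 4)) := by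
    rw [Metric.mem_closedBall, dist_comm]
    exact hxz.trans (max_le_max le_rfl (by linarith))
  obtain ⟨w, hw, hzw⟩ := mem_iUnion₂.1 (hcover hz)
  refine mem_iUnion₂.2 ⟨w, hw, ?_⟩
  rw [Metric.mem_ball] at hzw ⊢
  linarith [dist_triangle y z w]

lemma exists_gt_isCompact_closedBall [LocallyCompactSpace X] (h : HasAlmostMinimizingPaths X)
    {x : X} {ρ : ℝ} (hρ₀ : 0 ≤ ρ) (hρ : IsCompact (Metric.closedBall x ρ)) :
    ∃ r > ρ, IsCompact (Metric.closedBall x r) := by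
  obtain ⟨δ, hδ, hthick⟩ := hρ.exists_isCompact_cthickening
  refine ⟨ρ + δ / 2, by linarith, hthick.of_isClosed_subset Metric.isClosed_closedBall ?_⟩
  intro y hy
  rw [Metric.mem_closedBall, dist_comm] at hy
  obtain ⟨z, hyz, hxz⟩ := h.exists_dist_le_sub_half x y hδ
  refine Metric.mem_cthickening_of_dist_le y z δ _ ?_ hyz
  rw [Metric.mem_closedBall, dist_comm]
  exact hxz.trans (max_le hρ₀ (by linarith))

/-- **Hopf–Rinow**: the radii of the compact balls around a point form a set which is closed by
completeness and open by local compactness. -/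
theorem properSpace [CompleteSpace X] [LocallyCompactSpace X] (h : HasAlmostMinimizingPaths X) :
    ProperSpace X := by
  refine ⟨fun x r => ?_⟩
  by_contra hr
  set B := {r | ¬ IsCompact (Metric.closedBall x r)}
  have compact_mono : ∀ {r s : ℝ}, r ≤ s → IsCompact (Metric.closedBall x s) →
      IsCompact (Metric.closedBall x r) := fun hrs hs =>
    hs.of_isClosed_subset Metric.isClosed_closedBall (Metric.closedBall_subset_closedBall hrs)
  obtain ⟨r₀, hr₀, hcpt₀⟩ := Metric.exists_isCompact_closedBall x
  have hlower : r₀ ∈ lowerBounds B := fun s hs =>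
    le_of_not_ge fun hle => hs (compact_mono hle hcpt₀)
  have hpos : 0 < sInf B := hr₀.trans_le (le_csInf ⟨r, hr⟩ hlower)
  have hcpt : IsCompact (Metric.closedBall x (sInf B)) :=
    h.isCompact_closedBall_of_forall_lt hpos fun s hs =>
      not_not.1 fun hcon => hs.not_ge (csInf_le ⟨r₀, hlower⟩ hcon)
  obtain ⟨s, hs, hcpts⟩ := h.exists_gt_isCompact_closedBall hpos.le hcpt
  obtain ⟨t, htB, hts⟩ := exists_lt_of_csInf_lt ⟨r, hr⟩ hs
  exact htB (compact_mono hts.le hcpts)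

end HopfRinow

end HasAlmostMinimizingPaths

end LengthSpaces

/-! ### Geodesics in proper spaces -/

/-- `f` preserves distances on `s`. For `f : ℝ → X` and an interval `s` this says that `f`
restricts to a geodesic on `s`; values outside `s` are irrelevant. -/
def IsometryOn {X Y : Type*} [PseudoMetricSpace X] [PseudoMetricSpace Y] (f : X → Y) (s : Set X) :
    Prop :=
  ∀ x ∈ s, ∀ y ∈ s, dist (f x) (f y) = dist x y

namespace IsometryOn

variable {X Y : Type*} [PseudoMetricSpace X] [PseudoMetricSpace Y] {f : X → Y} {s t : Set X}

lemma mono (hf : IsometryOn f t) (hst : s ⊆ t) : IsometryOn f s :=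
  fun x hx y hy => hf x (hst hx) y (hst hy)

lemma comp {Z : Type*} [PseudoMetricSpace Z] {g : Z → X} {u : Set Z} (hf : IsometryOn f s)
    (hg : Isometry g) (hgu : MapsTo g u s) : IsometryOn (f ∘ g) u :=
  fun x hx y hy => (hf _ (hgu hx) _ (hgu hy)).trans (hg.dist_eq x y)

lemma of_tendsto {ι : Type*} {l : Filter ι} [l.NeBot] {F : ι → X → Y}
    (hF : ∀ x ∈ s, ∀ y ∈ s, ∀ᶠ i in l, dist (F i x) (F i y) = dist x y)
    (hlim : ∀ x ∈ s, Tendsto (F · x) l (𝓝 (f x))) : IsometryOn f s :=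
  fun x hx y hy => tendsto_nhds_unique_of_eventuallyEq ((hlim x hx).dist (hlim y hy))
    tendsto_const_nhds (hF x hx y hy)

end IsometryOn

/-- `σ` restricts to a geodesic `[0, dist x y] → X` from `x` to `y`. -/
structure IsGeodesicSegment {X : Type*} [PseudoMetricSpace X] (x y : X) (σ : ℝ → X) : Prop where
  isometryOn : IsometryOn σ (Icc 0 (dist x y))
  left : σ 0 = x
  right : σ (dist x y) = y

/-- Any two points of `X` are joined by a geodesic. -/
def IsGeodesicSpace (X : Type*) [PseudoMetricSpace X] : Prop :=
  ∀ x y : X, ∃ σ, IsGeodesicSegment x y σ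

theorem HasAlmostMinimizingPaths.isGeodesicSpace {X : Type*} [MetricSpace X] [ProperSpace X]
    (h : HasAlmostMinimizingPaths X) : IsGeodesicSpace X := by
  intro x y
  choose f hf using fun k : ℕ => h.exists_almost_geodesic x y (ε := 1 / ((k : ℝ) + 1))
    Nat.one_div_pos_of_nat
  have hε : Tendsto (fun k : ℕ => 1 / ((k : ℝ) + 1)) (hyperfilter ℕ : Filter ℕ) (𝓝 0) :=
    tendsto_one_div_add_atTop_nhds_zero_nat.mono_left Nat.hyperfilter_le_atTop
  have hball : ∀ k, f k ∈ univ.pi fun _ => Metric.closedBall x (dist x y) := fun k s _ => by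
    rw [Metric.mem_closedBall, dist_comm, (hf k s).1]
    exact s.2.2
  obtain ⟨σ, -, hσ⟩ := (isCompact_univ_pi fun _ => isCompact_closedBall x (dist x y))
    |>.ultrafilter_le_nhds' ((hyperfilter ℕ).map f) (Ultrafilter.mem_map.2 (univ_mem' hball))
  have hlim : ∀ s, Tendsto (f · s) (hyperfilter ℕ : Filter ℕ) (𝓝 (σ s)) := tendsto_pi_nhds.1 hσ
  have hxσ : ∀ s, dist x (σ s) = s := fun s =>
    tendsto_nhds_unique_of_eventuallyEq (tendsto_const_nhds.dist (hlim s)) tendsto_const_nhds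
      (.of_forall fun k => (hf k s).1)
  have hσy : ∀ s, dist (σ s) y ≤ dist x y - s := fun s => by
    simpa using le_of_tendsto_of_tendsto' ((hlim s).dist tendsto_const_nhds)
      (tendsto_const_nhds.add hε) fun k => (hf k s).2.1
  have hdist : ∀ s t, dist (σ s) (σ t) = dist s t := fun s t =>
    tendsto_nhds_unique ((hlim s).dist (hlim t)) <| tendsto_iff_dist_tendsto_zero.2 <|
      squeeze_zero (fun _ => dist_nonneg) (fun k => (hf k s).2.2 t) hε
  have h₀ : (0 : ℝ) ≤ dist x y := dist_nonneg
  refine ⟨fun t => σ (projIcc 0 _ h₀ t), fun s hs t ht => ?_, ?_, ?_⟩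
  · rw [hdist, projIcc_of_mem h₀ hs, projIcc_of_mem h₀ ht, Subtype.dist_eq]
  · rw [projIcc_left]
    exact (dist_eq_zero.1 (hxσ _)).symm
  · rw [projIcc_right]
    exact dist_le_zero.1 ((hσy _).trans_eq (sub_self _))

section ArzelaAscoli

variable {X : Type*} [MetricSpace X] [ProperSpace X]

theorem isCompact_setOf_lipschitzWith {Y : Type*} [PseudoMetricSpace Y] (K : NNReal) (o : X)
    (y₀ : Y) (R : ℝ) : IsCompact {f : C(Y, X) | LipschitzWith K f ∧ dist (f y₀) o ≤ R} := by
  refine ArzelaAscoli.isCompact_of_equicontinuous _ ?_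
    (LipschitzWith.uniformEquicontinuous _ K fun f => f.2.1).equicontinuous
  have himage : ContinuousMap.toFun '' {f : C(Y, X) | LipschitzWith K f ∧ dist (f y₀) o ≤ R} =
      {f : Y → X | LipschitzWith K f} ∩ {f | dist (f y₀) o ≤ R} := by
    ext f
    exact ⟨by rintro ⟨g, hg, rfl⟩; exact hg, fun hf => ⟨⟨f, hf.1.continuous⟩, hf, rfl⟩⟩
  rw [himage]
  refine (isCompact_univ_pi fun y => isCompact_closedBall o (K * dist y y₀ + R)).of_isClosed_subset
    ((isClosed_setOfPred_lipschitzWith K).inter <| isClosed_le (by fun_prop) continuous_const) ?_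
  intro f ⟨hf, hR⟩ y _
  exact (dist_triangle _ (f y₀) _).trans (add_le_add (hf.dist_le_mul y y₀) hR)

theorem exists_subseq_isometryOn_tendstoUniformlyOn {I : Set ℝ} {a b : ℕ → ℝ} {σ : ℕ → ℝ → X}
    {o : X} {R : ℝ} (ha : ∀ k, a k ≤ 0) (hb : ∀ k, 0 ≤ b k)
    (hσ : ∀ k, IsometryOn (σ k) (Icc (a k) (b k))) (hR : ∀ k, dist (σ k 0) o ≤ R)
    (hI : ∀ t ∈ I, ∀ᶠ k in atTop, t ∈ Icc (a k) (b k)) :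
    ∃ φ : ℕ → ℕ, StrictMono φ ∧ ∃ g, IsometryOn g I ∧
      ∀ c ∈ I, ∀ d ∈ I, TendstoUniformlyOn (fun j => σ (φ j)) g atTop (Icc c d) := by
  have hab : ∀ k, a k ≤ b k := fun k => (ha k).trans (hb k)
  set τ : ℕ → ℝ → X := fun k t => σ k (projIcc (a k) (b k) (hab k) t)
  have hτ : ∀ k, LipschitzWith 1 (τ k) := fun k => by
    refine .mk_one fun s t => ?_
    rw [hσ k _ (projIcc _ _ (hab k) s).2 _ (projIcc _ _ (hab k) t).2]
    simpa [Subtype.dist_eq] using (LipschitzWith.projIcc (hab k)).dist_le_mul s t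
  have hτσ : ∀ k, EqOn (τ k) (σ k) (Icc (a k) (b k)) := fun k t ht => by
    simp only [τ, projIcc_of_mem (hab k) ht]
  obtain ⟨g, -, φ, hφ, hg⟩ := (isCompact_setOf_lipschitzWith 1 o (0 : ℝ) R).tendsto_subseq
    (x := fun k => ⟨τ k, (hτ k).continuous⟩)
    fun k => ⟨hτ k, by simpa only [ContinuousMap.coe_mk, hτσ k ⟨ha k, hb k⟩] using hR k⟩
  have hunif : ∀ c ∈ I, ∀ d ∈ I, TendstoUniformlyOn (fun j => σ (φ j)) g atTop (Icc c d) := by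
    intro c hc d hd
    refine (ContinuousMap.tendsto_iff_forall_isCompact_tendstoUniformlyOn.1 hg _
      isCompact_Icc).congr ?_
    filter_upwards [hφ.tendsto_atTop.eventually (hI c hc), hφ.tendsto_atTop.eventually (hI d hd)]
      with j hcj hdj
    exact (hτσ (φ j)).mono (Icc_subset_Icc hcj.1 hdj.2)
  refine ⟨φ, hφ, g, .of_tendsto (l := atTop) (F := fun j => σ (φ j)) (fun s hs t ht => ?_)
    fun t ht => (hunif t ht t ht).tendsto_at ⟨le_rfl, le_rfl⟩, hunif⟩
  filter_upwards [hφ.tendsto_atTop.eventually (hI s hs), hφ.tendsto_atTop.eventually (hI t ht)]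
    with j hsj htj
  exact hσ (φ j) s hsj t htj

end ArzelaAscoli

section Geodesics

variable {X : Type*}

section PseudoMetric

variable [PseudoMetricSpace X] {x y : X} {σ : ℝ → X} {t : ℝ}

namespace IsGeodesicSegment

lemma const (x : X) : IsGeodesicSegment x x fun _ => x where
  isometryOn s hs t ht := by
    rw [dist_self, Icc_self, mem_singleton_iff] at hs ht
    rw [hs, ht, dist_self, dist_self]
  left := rfl
  right := rfl

lemma dist_left (h : IsGeodesicSegment x y σ) (ht : t ∈ Icc 0 (dist x y)) : dist x (σ t) = t := by
  rw [← h.left, h.isometryOn 0 ⟨le_rfl, dist_nonneg⟩ t ht, dist_comm, Real.dist_0_eq_abs,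
    abs_of_nonneg ht.1]

lemma dist_right (h : IsGeodesicSegment x y σ) (ht : t ∈ Icc 0 (dist x y)) :
    dist (σ t) y = dist x y - t := by
  conv_lhs => rw [← h.right]
  rw [h.isometryOn t ht _ ⟨dist_nonneg, le_rfl⟩, dist_comm, Real.dist_eq,
    abs_of_nonneg (sub_nonneg.2 ht.2)]

lemma symm (h : IsGeodesicSegment x y σ) : IsGeodesicSegment y x fun t => σ (dist x y - t) where
  isometryOn := by
    rw [dist_comm y x]
    exact h.isometryOn.comp (IsometryEquiv.subLeft (dist x y)).isometry
      fun t ht => ⟨sub_nonneg.2 ht.2, sub_le_self _ ht.1⟩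
  left := by rw [sub_zero, h.right]
  right := by rw [dist_comm y x, sub_self, h.left]

end IsGeodesicSegment

namespace IsometryOn

variable {g : ℝ → X}

lemma dist_zero_left (hg : IsometryOn g (Ici 0)) (ht : 0 ≤ t) : dist (g 0) (g t) = t := by
  rw [hg 0 self_mem_Ici t ht, dist_comm, Real.dist_0_eq_abs, abs_of_nonneg ht]

lemma isGeodesicSegment (hg : IsometryOn g (Ici 0)) (ht : 0 ≤ t) :
    IsGeodesicSegment (g 0) (g t) g where
  isometryOn := (hg.dist_zero_left ht).symm ▸ hg.mono Icc_subset_Ici_self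
  left := rfl
  right := by rw [hg.dist_zero_left ht]

lemma tendsto_dist_atTop (hg : IsometryOn g (Ici 0)) (o : X) :
    Tendsto (fun t => dist o (g t)) atTop atTop := by
  refine tendsto_atTop_mono' _ ?_ (tendsto_atTop_add_const_right _ (-dist o (g 0)) tendsto_id)
  filter_upwards [eventually_ge_atTop 0] with t ht
  simp only [id]
  linarith [hg.dist_zero_left ht, dist_triangle_left (g 0) (g t) o]

end IsometryOn

lemma IsGeodesicSegment.two_mul_sub_le_dist {o w : X} {α β : ℝ → X} {T : ℝ}
    (hα : IsGeodesicSegment o x α) (hβ : IsGeodesicSegment o y β)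
    (hw : dist x w + dist w y = dist x y) (hTx : T ∈ Icc 0 (dist o x))
    (hTy : T ∈ Icc 0 (dist o y)) : 2 * (T - dist o w) ≤ dist (α T) (β T) := by
  have hx := hα.dist_right hTx
  have hy := hβ.dist_right hTy
  linarith [dist_triangle4 x (α T) (β T) y, dist_triangle o w x, dist_triangle o w y,
    dist_comm x w, dist_comm x (α T)]

end PseudoMetric

theorem exists_subseq_ray_tendstoUniformlyOn [MetricSpace X] [ProperSpace X] {o : X} {R : ℕ → ℝ}
    {σ : ℕ → ℝ → X} (hR₀ : ∀ k, 0 ≤ R k) (hR : Tendsto R atTop atTop)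
    (hσ : ∀ k, IsometryOn (σ k) (Icc 0 (R k))) (ho : ∀ k, σ k 0 = o) :
    ∃ φ : ℕ → ℕ, StrictMono φ ∧ ∃ g, IsometryOn g (Ici 0) ∧ g 0 = o ∧
      ∀ T, TendstoUniformlyOn (fun j => σ (φ j)) g atTop (Icc 0 T) := by
  obtain ⟨φ, hφ, g, hg, hlim⟩ := exists_subseq_isometryOn_tendstoUniformlyOn (I := Ici 0) (R := 0)
    (fun _ => le_rfl) hR₀ hσ (fun k => (dist_eq_zero.2 (ho k)).le)
    fun t ht => (hR.eventually_ge_atTop t).mono fun k hk => ⟨ht, hk⟩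
  have h₀ := (hlim 0 self_mem_Ici 0 self_mem_Ici).tendsto_at ⟨le_rfl, le_rfl⟩
  refine ⟨φ, hφ, g, hg, tendsto_nhds_unique h₀ (by simp only [ho, tendsto_const_nhds]), fun T => ?_⟩
  rcases lt_or_ge T 0 with hT | hT
  · simp [Icc_eq_empty hT.not_ge, tendstoUniformlyOn_empty]
  · exact hlim 0 self_mem_Ici T hT

end Geodesics

/-! ### Slim triangles -/

/-- All geodesic triangles of `X` are `δ`-slim: each side is contained in the closed
`δ`-neighbourhood of the other two. -/
def HasSlimTriangles (X : Type*) [PseudoMetricSpace X] (δ : ℝ) : Prop :=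
  ∀ ⦃x y z : X⦄ ⦃σ₁ σ₂ σ₃ : ℝ → X⦄, IsGeodesicSegment x y σ₁ → IsGeodesicSegment y z σ₂ →
    IsGeodesicSegment z x σ₃ → ∀ s ∈ Icc 0 (dist x y),
      (∃ t ∈ Icc 0 (dist y z), dist (σ₁ s) (σ₂ t) ≤ δ) ∨
      (∃ t ∈ Icc 0 (dist z x), dist (σ₁ s) (σ₃ t) ≤ δ)

namespace HasSlimTriangles

section PseudoMetric

variable {X : Type*} [PseudoMetricSpace X] {δ : ℝ} {o : X}

lemma nonneg [Nonempty X] (h : HasSlimTriangles X δ) : 0 ≤ δ := by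
  obtain ⟨x⟩ := ‹Nonempty X›
  have hx := IsGeodesicSegment.const x
  rcases h hx hx hx 0 ⟨le_rfl, dist_nonneg⟩ with ⟨t, -, ht⟩ | ⟨t, -, ht⟩ <;>
    exact dist_nonneg.trans ht

theorem dist_le_two_mul (h : HasSlimTriangles X δ) {x y : X} {r t : ℝ} {α β σ : ℝ → X}
    (hα : IsGeodesicSegment o x α) (hβ : IsGeodesicSegment o y β) (hσ : IsGeodesicSegment x y σ)
    (hfar : ∀ s ∈ Icc 0 (dist x y), r + δ < dist o (σ s)) (ht : t ∈ Icc 0 r) :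
    dist (α t) (β t) ≤ 2 * δ := by
  have hδ : 0 ≤ δ := haveI : Nonempty X := ⟨o⟩; h.nonneg
  have hx := hfar 0 ⟨le_rfl, dist_nonneg⟩
  have hy := hfar _ ⟨dist_nonneg, le_rfl⟩
  rw [hσ.left] at hx
  rw [hσ.right] at hy
  have htx : t ∈ Icc 0 (dist o x) := ⟨ht.1, by linarith [ht.2]⟩
  have hty : t ∈ Icc 0 (dist o y) := ⟨ht.1, by linarith [ht.2]⟩
  have hoα := hα.dist_left htx
  rcases h hα hσ hβ.symm t htx with ⟨s, hs, hclose⟩ | ⟨u, hu, hclose⟩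
  · linarith [hfar s hs, ht.2, dist_triangle o (α t) (σ s)]
  · rw [dist_comm y o] at hu
    have hu' : dist o y - u ∈ Icc 0 (dist o y) := ⟨sub_nonneg.2 hu.2, sub_le_self _ hu.1⟩
    have hoβ := hβ.dist_left hu'
    have hβt := hβ.isometryOn _ hu' t hty
    have hut : dist (dist o y - u) t ≤ δ := by
      rw [Real.dist_eq, abs_le]
      constructor <;> linarith [dist_triangle o (α t) (β (dist o y - u)),
        dist_triangle_right o (α t) (β (dist o y - u))]
    linarith [dist_triangle (α t) (β (dist o y - u)) (β t)]

theorem dist_limit_le_two_mul (h : HasSlimTriangles X δ) {x y : ℕ → X} {α β σ : ℕ → ℝ → X}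
    {g g' : ℝ → X} (hα : ∀ k, IsGeodesicSegment o (x k) (α k))
    (hβ : ∀ k, IsGeodesicSegment o (y k) (β k)) (hσ : ∀ k, IsGeodesicSegment (x k) (y k) (σ k))
    (hfar : ∀ r, ∀ᶠ k in atTop, ∀ s ∈ Icc 0 (dist (x k) (y k)), r < dist o (σ k s))
    {t : ℝ} (ht : 0 ≤ t) (hg : Tendsto (fun k => α k t) atTop (𝓝 (g t)))
    (hg' : Tendsto (fun k => β k t) atTop (𝓝 (g' t))) : dist (g t) (g' t) ≤ 2 * δ :=
  le_of_tendsto (hg.dist hg') <| (hfar (t + δ)).mono fun k hk =>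
    h.dist_le_two_mul (hα k) (hβ k) (hσ k) hk ⟨ht, le_rfl⟩

end PseudoMetric

section Rays

variable {X : Type*} [PseudoMetricSpace X] {δ : ℝ} {g g' : ℝ → X}

theorem dist_ray_le_two_mul (hX : IsGeodesicSpace X) (h : HasSlimTriangles X δ)
    (hg : IsometryOn g (Ici 0)) (hg' : IsometryOn g' (Ici 0)) (h₀ : g 0 = g' 0) {M : ℝ}
    (hM : ∀ t, 0 ≤ t → dist (g t) (g' t) ≤ M) {t : ℝ} (ht : 0 ≤ t) :
    dist (g t) (g' t) ≤ 2 * δ := by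
  set T := max t (t + δ + M + 1)
  have hT : 0 ≤ T := ht.trans (le_max_left _ _)
  obtain ⟨σ, hσ⟩ := hX (g T) (g' T)
  refine h.dist_le_two_mul (hg.isGeodesicSegment hT) (h₀ ▸ hg'.isGeodesicSegment hT) hσ
    (fun s hs => ?_) ⟨ht, le_rfl⟩
  linarith [hg.dist_zero_left hT, hσ.dist_left hs, hs.2, hM T hT,
    dist_triangle_right (g 0) (g T) (σ s), le_max_right t (t + δ + M + 1)]

theorem exists_geodesic_near_base (hX : IsGeodesicSpace X) (h : HasSlimTriangles X δ)
    (hg : IsometryOn g (Ici 0)) (hg' : IsometryOn g' (Ici 0)) (h₀ : g 0 = g' 0) {T : ℝ}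
    (hT : 0 ≤ T) (hdiv : 2 * δ < dist (g T) (g' T)) {m : ℝ} (hm : 0 ≤ m) :
    ∃ (f : ℝ → X) (a b : ℝ), IsometryOn f (Icc (-a) b) ∧ f (-a) = g m ∧ f b = g' m ∧ 0 ≤ a ∧
      0 ≤ b ∧ m - (T + δ) ≤ a ∧ m - (T + δ) ≤ b ∧ dist (f 0) (g 0) ≤ T + δ := by
  obtain ⟨σ, hσ⟩ := hX (g m) (g' m)
  obtain ⟨s, hs, hclose⟩ : ∃ s ∈ Icc 0 (dist (g m) (g' m)), dist (g 0) (σ s) ≤ T + δ := by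
    by_contra! hfar
    -- A geodesic that stays away from the base point would keep the rays `2δ`-close up to time `T`.
    exact hdiv.not_ge (h.dist_le_two_mul (hg.isGeodesicSegment hm)
      (h₀ ▸ hg'.isGeodesicSegment hm) hσ hfar ⟨hT, le_rfl⟩)
  refine ⟨fun t => σ (s + t), s, dist (g m) (g' m) - s,
    hσ.isometryOn.comp (IsometryEquiv.addLeft s).isometry fun t ht => ?_, ?_, ?_, hs.1,
    sub_nonneg.2 hs.2, ?_, ?_, ?_⟩
  · exact ⟨neg_le_iff_add_nonneg'.1 ht.1, le_sub_iff_add_le'.1 ht.2⟩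
  · simp only [add_neg_cancel, hσ.left]
  · simp only [add_sub_cancel, hσ.right]
  · linarith [hσ.dist_left hs, hg.dist_zero_left hm, dist_triangle_right (g 0) (g m) (σ s)]
  · have hbase := hg'.dist_zero_left hm
    rw [← h₀] at hbase
    linarith [hσ.dist_right hs, dist_triangle (g 0) (σ s) (g' m)]
  · simpa only [add_zero, dist_comm] using hclose

end Rays

/-- That `ℓ` runs from the end of `g` to the end of `g'` is expressed by the approximating geodesics
`f j`, whose end points run off along the two rays. -/
theorem exists_line_tendsto {X : Type*} [MetricSpace X] [ProperSpace X] {δ : ℝ} {g g' : ℝ → X}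
    (hX : IsGeodesicSpace X) (h : HasSlimTriangles X δ) (hg : IsometryOn g (Ici 0))
    (hg' : IsometryOn g' (Ici 0)) (h₀ : g 0 = g' 0) {T : ℝ} (hT : 0 ≤ T)
    (hdiv : 2 * δ < dist (g T) (g' T)) :
    ∃ (f : ℕ → ℝ → X) (ℓ : ℝ → X) (m a b : ℕ → ℝ), IsometryOn ℓ univ ∧
      (∀ t, Tendsto (fun j => f j t) atTop (𝓝 (ℓ t))) ∧
      (∀ j, IsometryOn (f j) (Icc (-a j) (b j)) ∧ f j (-a j) = g (m j) ∧ f j (b j) = g' (m j)) ∧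
      Tendsto m atTop atTop ∧ Tendsto a atTop atTop ∧ Tendsto b atTop atTop := by
  choose f a b hf hfa hfb ha₀ hb₀ ha hb hbase using fun k : ℕ =>
    h.exists_geodesic_near_base hX hg hg' h₀ hT hdiv k.cast_nonneg
  have hcast := tendsto_natCast_atTop_atTop (R := ℝ)
  have hm := tendsto_atTop_add_const_right _ (-(T + δ)) hcast
  have ha_lim : Tendsto a atTop atTop := tendsto_atTop_mono ha hm
  have hb_lim : Tendsto b atTop atTop := tendsto_atTop_mono hb hm
  obtain ⟨φ, hφ, ℓ, hℓ, hlim⟩ := exists_subseq_isometryOn_tendstoUniformlyOn (I := univ)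
    (fun k => neg_nonpos.2 (ha₀ k)) hb₀ hf hbase fun t _ => by
      filter_upwards [ha_lim.eventually_ge_atTop (-t), hb_lim.eventually_ge_atTop t] with k hk hk'
      exact ⟨neg_le.1 hk, hk'⟩
  exact ⟨f ∘ φ, ℓ, fun j => φ j, a ∘ φ, b ∘ φ, hℓ,
    fun t => (hlim t trivial t trivial).tendsto_at ⟨le_rfl, le_rfl⟩,
    fun j => ⟨hf _, hfa _, hfb _⟩, hcast.comp hφ.tendsto_atTop, ha_lim.comp hφ.tendsto_atTop,
    hb_lim.comp hφ.tendsto_atTop⟩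

end HasSlimTriangles

/-! ### Kobayashi and Euclidean distance -/

section KobayashiEstimates

variable {n : ℕ} {D : Set (CSpace n)}

lemma exists_enorm_le_mul_kobayashiRoyden (hD : Bornology.IsBounded D) :
    ∃ C : ℝ, 0 < C ∧ ∀ z X : CSpace n, ‖X‖ₑ ≤ ENNReal.ofReal C * kobayashiRoyden D z X := by
  obtain ⟨C, hC⟩ := Metric.isBounded_iff.1 hD
  refine ⟨max C 1, by positivity, fun z X => ?_⟩
  rw [mul_comm, ← ENNReal.div_le_iff (by simp) ENNReal.ofReal_ne_top]
  refine le_sInf ?_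
  rintro r ⟨α, φ, hφ, hm, rfl, rfl, rfl⟩
  refine ENNReal.div_le_of_le_mul ?_
  rw [enorm_smul]
  gcongr
  rw [← ofReal_norm]
  refine ENNReal.ofReal_le_ofReal ?_
  have schwarz := Complex.norm_deriv_le_div_of_mapsTo_ball (R₂ := max C 1) hφ (fun w hw => ?_)
    one_pos
  · simpa using schwarz
  · exact (hC (hm hw) (hm (by simp))).trans (le_max_left _ _)

lemma kobayashiRoyden_le_of_ball_subset {z : CSpace n} {r : ℝ} (hr : 0 < r)
    (hz : Metric.ball z r ⊆ D) (X : CSpace n) :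
    kobayashiRoyden D z X ≤ ENNReal.ofReal (‖X‖ / r) := by
  rcases eq_or_ne X 0 with rfl | hX
  · rw [kobayashiRoyden_zero (hz (Metric.mem_ball_self hr))]
    exact bot_le
  have hX' : 0 < ‖X‖ := norm_pos_iff.2 hX
  have hd : ∀ w : ℂ, HasDerivAt (fun ζ : ℂ => z + ζ • (((r / ‖X‖ : ℝ) : ℂ) • X))
      (((r / ‖X‖ : ℝ) : ℂ) • X) w := fun w => by
    simpa using ((hasDerivAt_id w).smul_const (((r / ‖X‖ : ℝ) : ℂ) • X)).const_add z
  refine sInf_le ⟨((‖X‖ / r : ℝ) : ℂ), fun ζ => z + ζ • (((r / ‖X‖ : ℝ) : ℂ) • X),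
    fun w _ => (hd w).differentiableAt.differentiableWithinAt, fun w hw => hz ?_, by simp, ?_, ?_⟩
  · rw [mem_ball_iff_norm, add_sub_cancel_left, norm_smul, norm_smul, Complex.norm_real,
      Real.norm_of_nonneg (by positivity), div_mul_cancel₀ _ hX'.ne']
    have : ‖w‖ < 1 := by simpa using hw
    nlinarith
  · rw [(hd 0).deriv, smul_smul, ← Complex.ofReal_mul, div_mul_div_cancel₀ hr.ne',
      div_self hX'.ne', Complex.ofReal_one, one_smul]
  · rw [← ofReal_norm, Complex.norm_real, Real.norm_of_nonneg (by positivity)]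

lemma IsPiecewiseC1.exists_hasDerivAt {γ : ℝ → CSpace n} (h : IsPiecewiseC1 γ) :
    ∃ S : Finset ℝ, ∀ t ∈ Ioo (0 : ℝ) 1 \ S, HasDerivAt γ (deriv γ t) t := by
  obtain ⟨-, S, hS⟩ := h
  refine ⟨S, fun t ht => DifferentiableAt.hasDerivAt ?_⟩
  have hopen : IsOpen (Ioo (0 : ℝ) 1 \ S) := isOpen_Ioo.sdiff S.finite_toSet.isClosed
  obtain ⟨ε, hε, hball⟩ := Metric.isOpen_iff.1 hopen t ht
  have hsub : Icc (t - ε / 2) (t + ε / 2) ⊆ Ioo (0 : ℝ) 1 \ S := by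
    refine Subset.trans (fun s hs => ?_) hball
    rw [Metric.mem_ball, Real.dist_eq, abs_lt]
    constructor <;> linarith [hs.1, hs.2]
  have h1 := hsub (left_mem_Icc.2 (by linarith))
  have h2 := hsub (right_mem_Icc.2 (by linarith))
  refine ((hS (t - ε / 2) (t + ε / 2) h1.1.1.le h2.1.2.le fun s hs hs' =>
    (hsub (Ioo_subset_Icc_self hs')).2 hs).differentiableOn one_ne_zero).differentiableAt ?_
  exact Icc_mem_nhds (by linarith) (by linarith)

lemma enorm_sub_le_lintegral_deriv_of_isPiecewiseC1 {γ : ℝ → CSpace n} (h : IsPiecewiseC1 γ) :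
    ‖γ 1 - γ 0‖ₑ ≤ ∫⁻ t in Icc (0 : ℝ) 1, ‖deriv γ t‖ₑ := by
  obtain ⟨S, hS⟩ := h.exists_hasDerivAt
  rcases eq_or_ne (∫⁻ t in Icc (0 : ℝ) 1, ‖deriv γ t‖ₑ) ⊤ with htop | htop
  · exact htop ▸ le_top
  have hint : IntegrableOn (deriv γ) (Icc 0 1) :=
    ⟨(stronglyMeasurable_deriv γ).aestronglyMeasurable, htop.lt_top⟩
  rw [← integral_eq_of_hasDerivAt_off_countable_of_le γ (deriv γ) zero_le_one
    S.countable_toSet h.1 hS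
    ((intervalIntegrable_iff_integrableOn_Icc_of_le zero_le_one).2 hint),
    intervalIntegral.integral_of_le zero_le_one, ← integral_Icc_eq_integral_Ioc]
  exact enorm_integral_le_lintegral_enorm _

lemma exists_enorm_sub_le_mul_kobayashiEDist (hD : Bornology.IsBounded D) :
    ∃ C : ℝ, 0 < C ∧ ∀ x y : CSpace n,
      ‖x - y‖ₑ ≤ ENNReal.ofReal C * kobayashiEDist D x y := by
  obtain ⟨C, hC, h⟩ := exists_enorm_le_mul_kobayashiRoyden hD
  refine ⟨C, hC, fun x y => ?_⟩
  rw [mul_comm, ← ENNReal.div_le_iff (by simpa using hC) ENNReal.ofReal_ne_top]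
  refine le_sInf ?_
  rintro r ⟨γ, ⟨hγ, -, rfl, rfl⟩, rfl⟩
  refine ENNReal.div_le_of_le_mul ?_
  rw [enorm_sub_rev, mul_comm]
  refine (enorm_sub_le_lintegral_deriv_of_isPiecewiseC1 hγ).trans ?_
  rw [kobayashiLength, ← lintegral_const_mul' _ _ ENNReal.ofReal_ne_top]
  exact lintegral_mono fun t => h _ _

lemma kobayashiEDist_le_of_ball_subset {x y : CSpace n} {r : ℝ} (hr : 0 < r)
    (hx : Metric.ball x (2 * r) ⊆ D) (hy : y ∈ Metric.ball x r) :
    kobayashiEDist D x y ≤ ENNReal.ofReal (‖y - x‖ / r) := by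
  have hmem : ∀ t ∈ Icc (0 : ℝ) 1, x + t • (y - x) ∈ Metric.ball x r := fun t ht => by
    rw [mem_ball_iff_norm] at hy ⊢
    rw [add_sub_cancel_left, norm_smul, Real.norm_of_nonneg ht.1]
    nlinarith [ht.2, norm_nonneg (y - x)]
  have hderiv : ∀ t : ℝ, deriv (fun t : ℝ => x + t • (y - x)) t = y - x := fun t => by
    simpa using (((hasDerivAt_id t).smul_const (y - x)).const_add x).deriv
  have hsub : ∀ z ∈ Metric.ball x r, Metric.ball z r ⊆ D := fun z hz =>
    (Metric.ball_subset_ball' (by rw [Metric.mem_ball] at hz; linarith)).trans hx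
  have hc : ContDiff ℝ 1 fun t : ℝ => x + t • (y - x) := by fun_prop
  refine (kobayashiEDist_le D (γ := fun t : ℝ => x + t • (y - x))
    ⟨⟨hc.continuous.continuousOn, ∅, fun _ _ _ _ _ => hc.contDiffOn⟩,
      fun t ht => hsub _ (hmem t ht) (Metric.mem_ball_self hr), by simp, by simp⟩).trans ?_
  calc kobayashiLength D (fun t : ℝ => x + t • (y - x))
      ≤ ∫⁻ _ in Icc (0 : ℝ) 1, ENNReal.ofReal (‖y - x‖ / r) := by
        refine setLIntegral_mono' measurableSet_Icc fun t ht => ?_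
        rw [hderiv]
        exact kobayashiRoyden_le_of_ball_subset hr (hsub _ (hmem t ht)) _
    _ = _ := by simp

lemma kobayashiEDist_ne_top (hD : IsOpen D) (hc : IsPreconnected D) {x y : CSpace n}
    (hx : x ∈ D) (hy : y ∈ D) : kobayashiEDist D x y ≠ ⊤ := by
  refine (hc.induction₂ (fun x y => kobayashiEDist D x y < ⊤) (fun x hx => ?_)
    (fun x y z _ _ _ h₁ h₂ => ?_) (fun x y _ _ h => ?_) hx hy).ne
  · obtain ⟨r, hr, hball⟩ := Metric.isOpen_iff.1 hD x hx
    filter_upwards [mem_nhdsWithin_of_mem_nhds (Metric.ball_mem_nhds x (half_pos hr))] with y hy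
    refine (kobayashiEDist_le_of_ball_subset (half_pos hr) ?_ hy).trans_lt ENNReal.ofReal_lt_top
    rwa [mul_div_cancel₀ r two_ne_zero]
  · exact (kobayashiEDist_triangle D x y z).trans_lt (ENNReal.add_lt_top.2 ⟨h₁, h₂⟩)
  · rwa [kobayashiEDist_comm]

lemma kobayashiEDist_le_lintegral {x y : CSpace n} {γ : ℝ → CSpace n}
    (h : IsCurveJoining D x y γ) {a b : ℝ} (ha : 0 ≤ a) (hab : a ≤ b) (hb : b ≤ 1) :
    kobayashiEDist D (γ a) (γ b) ≤ ∫⁻ t in Ioo a b, kobayashiRoyden D (γ t) (deriv γ t) := by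
  obtain ⟨⟨hcont, S, hS⟩, hD, -, -⟩ := h
  rcases hab.eq_or_lt with rfl | hab
  · rw [kobayashiEDist_self (hD ⟨ha, hb⟩)]
    exact bot_le
  have hpos : 0 < b - a := sub_pos.2 hab
  have hmaps : ∀ s t : ℝ, MapsTo (fun u : ℝ => (b - a) * u + a) (Icc s t)
      (Icc ((b - a) * s + a) ((b - a) * t + a)) := fun s t u hu =>
    ⟨by simp only; nlinarith [hu.1], by simp only; nlinarith [hu.2]⟩
  have hmaps01 : MapsTo (fun u : ℝ => (b - a) * u + a) (Icc 0 1) (Icc 0 1) := fun u hu =>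
    ⟨by simp only; nlinarith [hu.1], by simp only; nlinarith [hu.2]⟩
  refine (kobayashiEDist_le D (γ := fun u => γ ((b - a) * u + a)) ⟨⟨?_, S.image fun s =>
    (s - a) / (b - a), fun s t hs ht hst => ?_⟩, hD.comp hmaps01, by simp, by simp⟩).trans ?_
  · exact hcont.comp (by fun_prop) hmaps01
  · refine (hS ((b - a) * s + a) ((b - a) * t + a) (by nlinarith) (by nlinarith) ?_).comp
      (by fun_prop) (hmaps s t)
    intro u hu hu'
    refine hst _ (Finset.mem_image_of_mem _ hu) ⟨?_, ?_⟩
    · rw [lt_div_iff₀ hpos]; linarith [hu'.1]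
    · rw [div_lt_iff₀ hpos]; linarith [hu'.2]
  · rw [kobayashiLength_eq_Ioo]
    refine lintegral_affine_le D γ _ (c := b - a) (d := a) hpos.ne' ?_ fun t _ => rfl
    rintro _ ⟨t, ht, rfl⟩
    exact ⟨by simp only; nlinarith [ht.1], by simp only; nlinarith [ht.2]⟩

lemma kobayashiEDist_add_add_le_kobayashiLength {x y : CSpace n} {γ : ℝ → CSpace n}
    (h : IsCurveJoining D x y γ) {a b : ℝ} (ha : 0 ≤ a) (hab : a ≤ b) (hb : b ≤ 1) :
    kobayashiEDist D x (γ a) + kobayashiEDist D (γ a) (γ b) + kobayashiEDist D (γ b) y ≤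
      kobayashiLength D γ := by
  have h1 := kobayashiEDist_le_lintegral h le_rfl ha (hab.trans hb)
  have h2 := kobayashiEDist_le_lintegral h ha hab hb
  have h3 := kobayashiEDist_le_lintegral h (ha.trans hab) hb le_rfl
  rw [h.2.2.1] at h1
  rw [h.2.2.2] at h3
  refine (add_le_add (add_le_add h1 h2) h3).trans ?_
  rw [← lintegral_union measurableSet_Ioo, ← lintegral_union measurableSet_Ioo,
    kobayashiLength_eq_Ioo]
  · refine lintegral_mono_set (union_subset (union_subset ?_ ?_) ?_) <;>
      exact Ioo_subset_Ioo (by linarith) (by linarith)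
  · refine Set.disjoint_left.2 ?_
    rintro t (ht | ht) ht' <;> linarith [ht.2, ht'.1]
  · exact Set.disjoint_left.2 fun t ht ht' => by linarith [ht.2, ht'.1]

end KobayashiEstimates

/-! ### The Kobayashi metric space of a bounded domain -/

section KobayashiSpace

variable {n : ℕ} {D : Set (CSpace n)}

/-- `D` is open, connected and bounded; being a class, this can be an assumption of the metric space
structure below. The empty set is allowed. -/
class IsBoundedDomain (D : Set (CSpace n)) : Prop where
  isOpen : IsOpen D
  isPreconnected : IsPreconnected D
  isBounded : Bornology.IsBounded D

namespace IsBoundedDomain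

variable [IsBoundedDomain D]

lemma kobayashiEDist_ne_top (x y : D) : kobayashiEDist D x y ≠ ⊤ :=
  _root_.kobayashiEDist_ne_top isOpen isPreconnected x.2 y.2

variable (D) in
lemma exists_norm_sub_le_mul_kobayashiDist :
    ∃ C > 0, ∀ x y : D, ‖(x - y : CSpace n)‖ ≤ C * kobayashiDist D x y := by
  obtain ⟨C, hC, h⟩ := exists_enorm_sub_le_mul_kobayashiEDist (D := D) isBounded
  refine ⟨C, hC, fun x y => ?_⟩
  have hxy := ENNReal.toReal_mono
    (ENNReal.mul_ne_top ENNReal.ofReal_ne_top (kobayashiEDist_ne_top x y)) (h x y)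
  rwa [toReal_enorm, ENNReal.toReal_mul, ENNReal.toReal_ofReal hC.le] at hxy

lemma exists_kobayashiDist_le_div (x : D) :
    ∃ r > 0, ∀ y ∈ Metric.ball (x : CSpace n) r, kobayashiDist D x y ≤ ‖y - x‖ / r := by
  obtain ⟨r, hr, hball⟩ := Metric.isOpen_iff.1 (isOpen (D := D)) x x.2
  refine ⟨r / 2, half_pos hr, fun y hy => ENNReal.toReal_le_of_le_ofReal (by positivity)
    (kobayashiEDist_le_of_ball_subset (half_pos hr) ?_ hy)⟩
  rwa [mul_div_cancel₀ r two_ne_zero]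

lemma isOpen_iff_kobayashiDist (s : Set D) :
    IsOpen s ↔ ∀ x ∈ s, ∃ ε > 0, ∀ y : D, kobayashiDist D x y < ε → y ∈ s := by
  obtain ⟨C, hC, hlow⟩ := exists_norm_sub_le_mul_kobayashiDist D
  refine Metric.isOpen_iff.trans (forall₂_congr fun x _ => ⟨?_, ?_⟩)
  · rintro ⟨ε, hε, h⟩
    refine ⟨ε / C, by positivity, fun y hy => h ?_⟩
    rw [lt_div_iff₀ hC] at hy
    rw [Metric.mem_ball, dist_comm, Subtype.dist_eq, dist_eq_norm]
    linarith [hlow x y]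
  · rintro ⟨ε, hε, h⟩
    obtain ⟨r, hr, hup⟩ := exists_kobayashiDist_le_div x
    refine ⟨min r (ε * r), by positivity, fun y hy => h y ?_⟩
    rw [Metric.mem_ball, Subtype.dist_eq] at hy
    refine (hup y (hy.trans_le (min_le_left _ _))).trans_lt ?_
    rw [div_lt_iff₀ hr, ← dist_eq_norm]
    exact hy.trans_le (min_le_right _ _)

end IsBoundedDomain

/-- The points of `D`, as a type which carries the Kobayashi distance instead of the Euclidean
one. -/
def KobayashiSpace (D : Set (CSpace n)) : Type := D

namespace KobayashiSpace

instance : CoeOut (KobayashiSpace D) (CSpace n) := ⟨Subtype.val⟩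

variable [IsBoundedDomain D]

open IsBoundedDomain in
noncomputable instance : MetricSpace (KobayashiSpace D) :=
  MetricSpace.ofDistTopology (α := D) (fun x y => kobayashiDist D x y)
    (fun x => by rw [kobayashiDist, kobayashiEDist_self x.2, ENNReal.toReal_zero])
    (fun x y => by rw [kobayashiDist, kobayashiEDist_comm, kobayashiDist])
    (fun x y z => by
      have hxy := kobayashiEDist_ne_top x y
      have hyz := kobayashiEDist_ne_top y z
      rw [kobayashiDist, kobayashiDist, kobayashiDist, ← ENNReal.toReal_add hxy hyz]
      exact ENNReal.toReal_mono (ENNReal.add_ne_top.2 ⟨hxy, hyz⟩) (kobayashiEDist_triangle D x y z))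
    isOpen_iff_kobayashiDist
    (fun x y hxy => by
      obtain ⟨C, -, h⟩ := exists_norm_sub_le_mul_kobayashiDist D
      refine Subtype.ext (sub_eq_zero.1 (norm_le_zero_iff.1 ((h x y).trans_eq ?_)))
      rw [hxy, mul_zero])

lemma dist_def (x y : KobayashiSpace D) : dist x y = kobayashiDist D x y := rfl

variable (D) in
lemma isOpenEmbedding_coe : IsOpenEmbedding fun x : KobayashiSpace D => (x : CSpace n) :=
  IsBoundedDomain.isOpen.isOpenEmbedding_subtypeVal

variable (D) in
lemma uniformContinuous_coe : UniformContinuous fun x : KobayashiSpace D => (x : CSpace n) := by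
  obtain ⟨C, -, h⟩ := IsBoundedDomain.exists_norm_sub_le_mul_kobayashiDist D
  refine (LipschitzWith.of_dist_le_mul (K := C.toNNReal) fun x y => ?_).uniformContinuous
  exact ((dist_eq_norm _ _).trans_le (h x y)).trans
    (mul_le_mul_of_nonneg_right (Real.le_coe_toNNReal C) ENNReal.toReal_nonneg)

instance : LocallyCompactSpace (KobayashiSpace D) := (isOpenEmbedding_coe D).locallyCompactSpace

variable (D) in
theorem hasAlmostMinimizingPaths : HasAlmostMinimizingPaths (KobayashiSpace D) := by
  intro x y ε hε
  have hlt : kobayashiEDist D x y < kobayashiEDist D x y + ENNReal.ofReal ε :=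
    ENNReal.lt_add_right (IsBoundedDomain.kobayashiEDist_ne_top x y) (by simpa using hε)
  obtain ⟨_, ⟨γ, hγ, rfl⟩, hlen⟩ := sInf_lt_iff.1 hlt
  let c : Path x y :=
    { toFun := fun t => ⟨γ t, hγ.2.1 t.2⟩
      continuous_toFun := (continuousOn_iff_continuous_domRestrict.1 hγ.1.1).subtype_mk _
      source' := Subtype.ext hγ.2.2.1
      target' := Subtype.ext hγ.2.2.2 }
  refine ⟨c, fun a b hab => ?_⟩
  have hsum := (kobayashiEDist_add_add_le_kobayashiLength hγ a.2.1 hab b.2.2).trans hlen.le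
  have hxa : kobayashiEDist D x (γ a) ≠ ⊤ := IsBoundedDomain.kobayashiEDist_ne_top x (c a)
  have hab' : kobayashiEDist D (γ a) (γ b) ≠ ⊤ := IsBoundedDomain.kobayashiEDist_ne_top (c a) (c b)
  have hby : kobayashiEDist D (γ b) y ≠ ⊤ := IsBoundedDomain.kobayashiEDist_ne_top (c b) y
  have hreal := ENNReal.toReal_mono
    (ENNReal.add_ne_top.2 ⟨IsBoundedDomain.kobayashiEDist_ne_top x y, ENNReal.ofReal_ne_top⟩) hsum
  rwa [ENNReal.toReal_add (ENNReal.add_ne_top.2 ⟨hxa, hab'⟩) hby, ENNReal.toReal_add hxa hab',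
    ENNReal.toReal_add (IsBoundedDomain.kobayashiEDist_ne_top x y) ENNReal.ofReal_ne_top,
    ENNReal.toReal_ofReal hε.le] at hreal

theorem properSpace (hD : IsCompleteHyperbolic D) : ProperSpace (KobayashiSpace D) := by
  have : CompleteSpace (KobayashiSpace D) := by
    refine Metric.complete_of_cauchySeq_tendsto fun u hu => ?_
    obtain ⟨x, hx, hlim⟩ := hD.2 (fun k => u k) (fun k => (u k).2) (Metric.cauchySeq_iff.1 hu)
    exact ⟨⟨x, hx⟩, tendsto_iff_dist_tendsto_zero.2 hlim⟩
  exact (hasAlmostMinimizingPaths D).properSpace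

variable (D) in
theorem isGeodesicSpace [ProperSpace (KobayashiSpace D)] : IsGeodesicSpace (KobayashiSpace D) :=
  (hasAlmostMinimizingPaths D).isGeodesicSpace

end KobayashiSpace

end KobayashiSpace

section KobayashiGeodesics

variable {n : ℕ} {D : Set (CSpace n)} [IsBoundedDomain D]

lemma isGeodesicOn_coe_iff {I : Set ℝ} {σ : ℝ → KobayashiSpace D} :
    IsGeodesicOn D I (fun t => σ t) ↔ IsometryOn σ I :=
  and_iff_right fun t _ => (σ t).2

lemma IsGeodesicOn.exists_isometryOn_eqOn {γ : ℝ → CSpace n} {I : Set ℝ}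
    (h : IsGeodesicOn D I γ) (hI : I.Nonempty) :
    ∃ σ : ℝ → KobayashiSpace D, IsometryOn σ I ∧ EqOn (fun t => (σ t : CSpace n)) γ I := by
  classical
  obtain ⟨t₀, ht₀⟩ := hI
  let σ : ℝ → KobayashiSpace D := fun t =>
    if ht : t ∈ I then ⟨γ t, h.1 ht⟩ else ⟨γ t₀, h.1 ht₀⟩
  have hσ : EqOn (fun t => (σ t : CSpace n)) γ I :=
    fun t ht => congrArg Subtype.val (dif_pos ht)
  exact ⟨σ, fun s hs t ht =>
    (congrArg₂ (kobayashiDist D) (hσ hs) (hσ ht)).trans (h.2 s hs t ht), hσ⟩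

lemma IsGeodesicSegment.isGeodesicJoining {x y : KobayashiSpace D} {σ : ℝ → KobayashiSpace D}
    (h : IsGeodesicSegment x y σ) : IsGeodesicJoining D x y (dist x y) fun t => σ t :=
  ⟨dist_nonneg, isGeodesicOn_coe_iff.2 h.isometryOn, congrArg _ h.left, congrArg _ h.right⟩

lemma IsGeodesicJoining.length_eq {x y : KobayashiSpace D} {L : ℝ} {γ : ℝ → CSpace n}
    (h : IsGeodesicJoining D x y L γ) : L = dist x y := by
  obtain ⟨hL, hγ, h₀, h₁⟩ := h
  rw [KobayashiSpace.dist_def, ← h₀, ← h₁, hγ.2 0 ⟨le_rfl, hL⟩ L ⟨hL, le_rfl⟩, zero_sub, abs_neg,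
    abs_of_nonneg hL]

lemma IsGeodesicJoining.exists_isGeodesicSegment_eqOn {x y : KobayashiSpace D} {L : ℝ}
    {γ : ℝ → CSpace n} (h : IsGeodesicJoining D x y L γ) :
    ∃ σ : ℝ → KobayashiSpace D, IsGeodesicSegment x y σ ∧
      EqOn (fun t => (σ t : CSpace n)) γ (Icc 0 L) := by
  obtain rfl := h.length_eq
  obtain ⟨hL, hγ, h₀, h₁⟩ := h
  obtain ⟨σ, hσ, hσγ⟩ := hγ.exists_isometryOn_eqOn (nonempty_Icc.2 hL)
  exact ⟨σ, ⟨hσ, Subtype.ext ((hσγ ⟨le_rfl, hL⟩).trans h₀),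
    Subtype.ext ((hσγ ⟨hL, le_rfl⟩).trans h₁)⟩, hσγ⟩

theorem IsGromovHyperbolic.exists_hasSlimTriangles (h : IsGromovHyperbolic D) :
    ∃ δ, HasSlimTriangles (KobayashiSpace D) δ := by
  obtain ⟨δ, hδ⟩ := h
  exact ⟨δ, fun x y z σ₁ σ₂ σ₃ h₁ h₂ h₃ => hδ x y z _ _ _ _ _ _ h₁.isGeodesicJoining
    h₂.isGeodesicJoining h₃.isGeodesicJoining⟩

/-! ### The boundary of the Kobayashi metric space -/

namespace KobayashiSpace

lemma tendsto_coe_iff {ι : Type*} {l : Filter ι} {z : ι → KobayashiSpace D} {x : KobayashiSpace D} :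
    Tendsto (fun i => (z i : CSpace n)) l (𝓝 (x : CSpace n)) ↔ Tendsto z l (𝓝 x) :=
  (isOpenEmbedding_coe D).tendsto_nhds_iff.symm

lemma notMem_of_tendsto {ι : Type*} {l : Filter ι} [l.NeBot] {o : KobayashiSpace D}
    {z : ι → KobayashiSpace D} {p : CSpace n} (hz : Tendsto (fun i => dist o (z i)) l atTop)
    (hp : Tendsto (fun i => (z i : CSpace n)) l (𝓝 p)) : p ∉ D := fun hpD =>
  not_tendsto_nhds_of_tendsto_atTop hz _
    (tendsto_const_nhds.dist (tendsto_coe_iff (x := (⟨p, hpD⟩ : KobayashiSpace D)).1 hp))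

lemma mem_frontier_of_tendsto {ι : Type*} {l : Filter ι} [l.NeBot] {o : KobayashiSpace D}
    {z : ι → KobayashiSpace D} {p : CSpace n} (hz : Tendsto (fun i => dist o (z i)) l atTop)
    (hp : Tendsto (fun i => (z i : CSpace n)) l (𝓝 p)) : p ∈ frontier D := by
  rw [(IsBoundedDomain.isOpen (D := D)).frontier_eq]
  exact ⟨mem_closure_of_tendsto hp (Eventually.of_forall fun i => (z i).2),
    notMem_of_tendsto hz hp⟩

lemma tendsto_dist_atTop [ProperSpace (KobayashiSpace D)] {ι : Type*} {l : Filter ι}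
    {z : ι → KobayashiSpace D} {p : CSpace n} (o : KobayashiSpace D) (hpD : p ∉ D)
    (hp : Tendsto (fun i => (z i : CSpace n)) l (𝓝 p)) :
    Tendsto (fun i => dist o (z i)) l atTop := by
  refine tendsto_atTop.2 fun r => ?_
  let K : Set (CSpace n) := (fun x : KobayashiSpace D => (x : CSpace n)) '' Metric.closedBall o r
  have hK : IsClosed K :=
    ((isCompact_closedBall o r).image (isOpenEmbedding_coe D).continuous).isClosed
  have hpK : p ∉ K := fun ⟨x, _, hx⟩ => hpD (hx ▸ x.2)
  filter_upwards [hp.eventually_mem (hK.isOpen_compl.mem_nhds hpK)] with i hi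
  exact le_of_not_ge fun h => hi ⟨z i, Metric.mem_closedBall'.2 h, rfl⟩

end KobayashiSpace

end KobayashiGeodesics

/-! ### The Gromov compactification -/

section GromovCompactification

variable {n : ℕ} {D : Set (CSpace n)}

section Topology

variable {z₀ : D} {τ : GromovBoundary D z₀}

lemma PointsConverge.tendsto {z : ℕ → D} (h : PointsConverge z τ) :
    Tendsto (fun k => GromovCompactification.inner (z₀ := z₀) (z k)) atTop
      (𝓝 (GromovCompactification.ideal τ)) :=
  tendsto_nhds.2 fun _ hW hτ => (hW.2 τ hτ).1 z h

lemma ClassesConverge.tendsto {s : ℕ → GromovBoundary D z₀} (h : ClassesConverge s τ) :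
    Tendsto (fun k => GromovCompactification.ideal (s k)) atTop
      (𝓝 (GromovCompactification.ideal τ)) :=
  tendsto_nhds.2 fun _ hW hτ => (hW.2 τ hτ).2 s h

lemma GromovCompactification.continuous_inner :
    Continuous (GromovCompactification.inner (D := D) (z₀ := z₀)) :=
  continuous_def.2 fun _ hW => hW.1

lemma GromovCompactification.continuous_of_tendsto {Y : Type*} [TopologicalSpace Y]
    {f : GromovCompactification D z₀ → Y} (hinner : Continuous fun z => f (inner z))
    (hpoints : ∀ z σ, PointsConverge z σ →
      Tendsto (fun k => f (inner (z k))) atTop (𝓝 (f (ideal σ))))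
    (hclasses : ∀ s σ, ClassesConverge s σ →
      Tendsto (fun k => f (ideal (s k))) atTop (𝓝 (f (ideal σ)))) : Continuous f :=
  continuous_def.2 fun _ hO => ⟨hO.preimage hinner, fun σ hσ =>
    ⟨fun z hz => (hpoints z σ hz).eventually (hO.mem_nhds hσ),
      fun s hs => (hclasses s σ hs).eventually (hO.mem_nhds hσ)⟩⟩

end Topology

variable {z₀ : KobayashiSpace D}

namespace GeodesicRay

/-- The ray as a curve in the Kobayashi metric space, extended to negative times by its initial
point. -/
def curve (γ : GeodesicRay D z₀) (t : ℝ) : KobayashiSpace D :=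
  ⟨γ.1 (max t 0), γ.2.1.1 (le_max_right t 0)⟩

/-- The class of a ray in the Gromov boundary. -/
def toBoundary (γ : GeodesicRay D z₀) : GromovBoundary D z₀ :=
  Quotient.mk (geodesicRaySetoid D z₀) γ

variable {γ η : GeodesicRay D z₀} {t : ℝ}

lemma coe_curve (γ : GeodesicRay D z₀) (ht : 0 ≤ t) : (γ.curve t : CSpace n) = γ.1 t :=
  congrArg γ.1 (max_eq_left ht)

lemma curve_zero (γ : GeodesicRay D z₀) : γ.curve 0 = z₀ :=
  Subtype.ext ((γ.coe_curve le_rfl).trans γ.2.2)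

variable [IsBoundedDomain D]

lemma isometryOn_curve (γ : GeodesicRay D z₀) : IsometryOn γ.curve (Ici 0) := fun s hs t ht => by
  refine (γ.2.1.2 _ (le_max_right s 0) _ (le_max_right t 0)).trans ?_
  rw [max_eq_left hs, max_eq_left ht, Real.dist_eq]

lemma dist_curve (γ : GeodesicRay D z₀) (ht : 0 ≤ t) : dist z₀ (γ.curve t) = t := by
  simpa only [curve_zero] using γ.isometryOn_curve.dist_zero_left ht

lemma isGeodesicSegment_curve (γ : GeodesicRay D z₀) (ht : 0 ≤ t) :
    IsGeodesicSegment z₀ (γ.curve t) γ.curve := by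
  simpa only [curve_zero] using γ.isometryOn_curve.isGeodesicSegment ht

lemma exists_eqOn_curve {g : ℝ → KobayashiSpace D} (hg : IsometryOn g (Ici 0)) (h₀ : g 0 = z₀) :
    ∃ η : GeodesicRay D z₀, EqOn η.curve g (Ici 0) :=
  ⟨⟨fun t => g t, isGeodesicOn_coe_iff.2 hg, congrArg _ h₀⟩,
    fun _ ht => congrArg g (max_eq_left ht)⟩

lemma toBoundary_eq_iff :
    γ.toBoundary = η.toBoundary ↔ ∃ M, ∀ t, 0 ≤ t → dist (γ.curve t) (η.curve t) ≤ M := by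
  have hcurve : ∀ t, 0 ≤ t → kobayashiEDist D (γ.1 t) (η.1 t) =
      ENNReal.ofReal (dist (γ.curve t) (η.curve t)) := fun t ht => by
    rw [KobayashiSpace.dist_def, kobayashiDist, ENNReal.ofReal_toReal
      (IsBoundedDomain.kobayashiEDist_ne_top (γ.curve t) (η.curve t)), coe_curve γ ht,
      coe_curve η ht]
  have hsup : ⨆ t ∈ Ici (0 : ℝ), kobayashiEDist D (γ.1 t) (η.1 t) =
      ⨆ t ∈ Ici (0 : ℝ), ENNReal.ofReal (dist (γ.curve t) (η.curve t)) := biSup_congr hcurve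
  refine (Quotient.eq.trans (iff_of_eq (congrArg (· < ⊤) hsup))).trans ?_
  constructor
  · intro h
    exact ⟨_, fun t ht => (ENNReal.ofReal_le_iff_le_toReal h.ne).1
      (le_iSup₂ (f := fun t (_ : t ∈ Ici (0 : ℝ)) =>
        ENNReal.ofReal (dist (γ.curve t) (η.curve t))) t ht)⟩
  · rintro ⟨M, hM⟩
    exact (iSup₂_le fun t ht => ENNReal.ofReal_le_ofReal (hM t ht)).trans_lt ENNReal.ofReal_lt_top

end GeodesicRay

variable [IsBoundedDomain D] {γ : ℕ → ℝ → CSpace n} {α : ℕ → ℝ → KobayashiSpace D}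
  {η : GeodesicRay D z₀} {τ : GromovBoundary D z₀}

lemma limitRayInClass_toBoundary
    (hα : ∀ T, TendstoUniformlyOn α η.curve atTop (Icc 0 T))
    (hαγ : ∀ T, ∀ᶠ k in atTop, EqOn (fun t => (α k t : CSpace n)) (γ k) (Icc 0 T)) :
    LimitRayInClass γ η.toBoundary :=
  ⟨η, rfl, fun T => (((KobayashiSpace.uniformContinuous_coe D).comp_tendstoUniformlyOn
    (hα T)).congr (hαγ T)).congr_right fun _ ht => η.coe_curve ht.1⟩

lemma LimitRayInClass.exists_tendsto (h : LimitRayInClass γ τ)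
    (hαγ : ∀ t, 0 ≤ t → ∀ᶠ k in atTop, (α k t : CSpace n) = γ k t) :
    ∃ η : GeodesicRay D z₀, η.toBoundary = τ ∧
      ∀ t, 0 ≤ t → Tendsto (fun k => α k t) atTop (𝓝 (η.curve t)) := by
  obtain ⟨η, hητ, hη⟩ := h
  refine ⟨η, hητ, fun t ht => KobayashiSpace.tendsto_coe_iff.1 ?_⟩
  rw [η.coe_curve ht, tendsto_congr' (hαγ t ht)]
  exact (hη t).tendsto_at ⟨ht, le_rfl⟩

theorem PointsConverge.exists_subseq {z : ℕ → KobayashiSpace D} (h : PointsConverge z τ)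
    (hα : ∀ k, IsGeodesicSegment z₀ (z k) (α k)) {φ : ℕ → ℕ} (hφ : StrictMono φ) :
    ∃ ψ : ℕ → ℕ, StrictMono ψ ∧ Tendsto (fun j => dist z₀ (z (φ (ψ j)))) atTop atTop ∧
      ∃ η : GeodesicRay D z₀, η.toBoundary = τ ∧
        ∀ t, 0 ≤ t → Tendsto (fun j => α (φ (ψ j)) t) atTop (𝓝 (η.curve t)) := by
  obtain ⟨ψ, hψ, hR, hlim⟩ := h _ _ (fun k => (hα k).isGeodesicJoining) φ hφ
  exact ⟨ψ, hψ, hR, hlim.exists_tendsto fun _ _ => Eventually.of_forall fun _ => rfl⟩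

theorem ClassesConverge.exists_subseq {γ : ℕ → GeodesicRay D z₀}
    (h : ClassesConverge (fun k => (γ k).toBoundary) τ) {φ : ℕ → ℕ} (hφ : StrictMono φ) :
    ∃ ψ : ℕ → ℕ, StrictMono ψ ∧ ∃ η : GeodesicRay D z₀, η.toBoundary = τ ∧
      ∀ t, 0 ≤ t → Tendsto (fun j => (γ (φ (ψ j))).curve t) atTop (𝓝 (η.curve t)) := by
  obtain ⟨ψ, hψ, hlim⟩ := h γ (fun _ => rfl) φ hφ
  exact ⟨ψ, hψ, hlim.exists_tendsto fun _ ht => Eventually.of_forall fun _ =>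
    GeodesicRay.coe_curve _ ht⟩

section Proper

variable [ProperSpace (KobayashiSpace D)]

lemma exists_subseq_geodesicRay {R : ℕ → ℝ} (hR₀ : ∀ k, 0 ≤ R k) (hR : Tendsto R atTop atTop)
    (hα : ∀ k, IsometryOn (α k) (Icc 0 (R k))) (h₀ : ∀ k, α k 0 = z₀) :
    ∃ φ : ℕ → ℕ, StrictMono φ ∧ ∃ η : GeodesicRay D z₀,
      ∀ T, TendstoUniformlyOn (fun j => α (φ j)) η.curve atTop (Icc 0 T) := by
  obtain ⟨φ, hφ, g, hg, hg₀, hlim⟩ := exists_subseq_ray_tendstoUniformlyOn hR₀ hR hα h₀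
  obtain ⟨η, hη⟩ := GeodesicRay.exists_eqOn_curve hg hg₀
  exact ⟨φ, hφ, η, fun T => (hlim T).congr_right fun t ht => (hη ht.1).symm⟩

lemma exists_subseq_geodesicRay_of_segments {z : ℕ → KobayashiSpace D}
    (hα : ∀ k, IsGeodesicSegment z₀ (z k) (α k))
    (hz : Tendsto (fun k => dist z₀ (z k)) atTop atTop) :
    ∃ φ : ℕ → ℕ, StrictMono φ ∧ ∃ η : GeodesicRay D z₀,
      ∀ T, TendstoUniformlyOn (fun j => α (φ j)) η.curve atTop (Icc 0 T) :=
  exists_subseq_geodesicRay (fun _ => dist_nonneg) hz (fun k => (hα k).isometryOn)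
    fun k => (hα k).left

lemma exists_subseq_geodesicRay_of_rays (γ : ℕ → GeodesicRay D z₀) :
    ∃ φ : ℕ → ℕ, StrictMono φ ∧ ∃ η : GeodesicRay D z₀,
      ∀ T, TendstoUniformlyOn (fun j => (γ (φ j)).curve) η.curve atTop (Icc 0 T) :=
  exists_subseq_geodesicRay (R := fun k => k) (fun k => k.cast_nonneg) tendsto_natCast_atTop_atTop
    (fun k => (γ k).isometryOn_curve.mono Icc_subset_Ici_self) fun k => (γ k).curve_zero

variable {δ : ℝ} (hδ : HasSlimTriangles (KobayashiSpace D) δ)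
include hδ

theorem pointsConverge_of_tendsto {z : ℕ → KobayashiSpace D}
    (hα : ∀ k, IsGeodesicSegment z₀ (z k) (α k))
    (hz : Tendsto (fun k => dist z₀ (z k)) atTop atTop)
    (hlim : ∀ t, 0 ≤ t → Tendsto (fun k => α k t) atTop (𝓝 (η.curve t))) :
    PointsConverge z η.toBoundary := by
  intro R γ hγ φ hφ
  obtain rfl : R = fun k => dist z₀ (z k) := funext fun k => (hγ k).length_eq
  choose β hβ hβγ using fun k => (hγ k).exists_isGeodesicSegment_eqOn
  have hzφ := hz.comp hφ.tendsto_atTop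
  obtain ⟨ψ, hψ, θ, hθ⟩ := exists_subseq_geodesicRay_of_segments (fun k => hβ (φ k)) hzφ
  have hφψ := (hφ.comp hψ).tendsto_atTop
  have hηθ : η.toBoundary = θ.toBoundary :=
    GeodesicRay.toBoundary_eq_iff.2 ⟨2 * δ, fun t ht => hδ.dist_limit_le_two_mul
      (fun j => hα (φ (ψ j))) (fun j => hβ (φ (ψ j))) (fun _ => .const _)
      (fun r => ((hz.comp hφψ).eventually_gt_atTop r).mono fun _ hj _ _ => hj) ht
      ((hlim t ht).comp hφψ) ((hθ t).tendsto_at ⟨ht, le_rfl⟩)⟩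
  refine ⟨ψ, hψ, hz.comp hφψ, hηθ ▸ limitRayInClass_toBoundary hθ fun T => ?_⟩
  filter_upwards [(hz.comp hφψ).eventually_ge_atTop T] with j hj
  exact (hβγ (φ (ψ j))).mono (Icc_subset_Icc_right hj)

theorem classesConverge_of_tendsto {γ : ℕ → GeodesicRay D z₀}
    (hlim : ∀ t, 0 ≤ t → Tendsto (fun k => (γ k).curve t) atTop (𝓝 (η.curve t))) :
    ClassesConverge (fun k => (γ k).toBoundary) η.toBoundary := by
  intro γ' hγ φ hφ
  obtain ⟨ψ, hψ, θ, hθ⟩ := exists_subseq_geodesicRay_of_rays fun k => γ' (φ k)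
  have hclose : ∀ k t, 0 ≤ t → dist ((γ k).curve t) ((γ' k).curve t) ≤ 2 * δ := fun k t ht => by
    obtain ⟨M, hM⟩ := GeodesicRay.toBoundary_eq_iff.1 (hγ k).symm
    exact hδ.dist_ray_le_two_mul (KobayashiSpace.isGeodesicSpace D) (γ k).isometryOn_curve
      (γ' k).isometryOn_curve (by simp only [GeodesicRay.curve_zero]) hM ht
  have hηθ : η.toBoundary = θ.toBoundary :=
    GeodesicRay.toBoundary_eq_iff.2 ⟨2 * δ, fun t ht => le_of_tendsto
      (((hlim t ht).comp (hφ.comp hψ).tendsto_atTop).dist ((hθ t).tendsto_at ⟨ht, le_rfl⟩))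
      (Eventually.of_forall fun _ => hclose _ t ht)⟩
  exact ⟨ψ, hψ, hηθ ▸ limitRayInClass_toBoundary hθ fun T => Eventually.of_forall fun _ _ ht =>
    GeodesicRay.coe_curve _ ht.1⟩

theorem exists_subseq_pointsConverge {z : ℕ → KobayashiSpace D}
    (hz : Tendsto (fun k => dist z₀ (z k)) atTop atTop) :
    ∃ φ : ℕ → ℕ, StrictMono φ ∧ ∃ σ : GromovBoundary D z₀,
      PointsConverge (fun j => z (φ j)) σ := by
  choose α hα using fun k => KobayashiSpace.isGeodesicSpace D z₀ (z k)
  obtain ⟨φ, hφ, η, hη⟩ := exists_subseq_geodesicRay_of_segments hα hz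
  exact ⟨φ, hφ, _, pointsConverge_of_tendsto hδ (fun k => hα (φ k))
    (hz.comp hφ.tendsto_atTop) fun t ht => (hη t).tendsto_at ⟨ht, le_rfl⟩⟩

theorem exists_subseq_classesConverge (s : ℕ → GromovBoundary D z₀) :
    ∃ φ : ℕ → ℕ, StrictMono φ ∧ ∃ σ : GromovBoundary D z₀,
      ClassesConverge (fun j => s (φ j)) σ := by
  choose γ hγ using fun k => Quotient.exists_rep (s k)
  obtain rfl : (fun k => (γ k).toBoundary) = s := funext hγ
  obtain ⟨φ, hφ, η, hη⟩ := exists_subseq_geodesicRay_of_rays γ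
  exact ⟨φ, hφ, η.toBoundary, classesConverge_of_tendsto hδ fun t ht =>
    (hη t).tendsto_at ⟨ht, le_rfl⟩⟩

theorem exists_subseq_pointsConverge_pair {x y : ℕ → KobayashiSpace D}
    {σ : ℕ → ℝ → KobayashiSpace D} (hσ : ∀ k, IsGeodesicSegment (x k) (y k) (σ k))
    (hfar : ∀ r, ∀ᶠ k in atTop, ∀ s ∈ Icc 0 (dist (x k) (y k)), r < dist z₀ (σ k s)) :
    ∃ φ : ℕ → ℕ, StrictMono φ ∧ ∃ τ : GromovBoundary D z₀,
      PointsConverge (fun j => x (φ j)) τ ∧ PointsConverge (fun j => y (φ j)) τ := by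
  have hx : Tendsto (fun k => dist z₀ (x k)) atTop atTop := tendsto_atTop.2 fun r =>
    (hfar r).mono fun k hk => (hσ k).left ▸ (hk 0 ⟨le_rfl, dist_nonneg⟩).le
  have hy : Tendsto (fun k => dist z₀ (y k)) atTop atTop := tendsto_atTop.2 fun r =>
    (hfar r).mono fun k hk => by
      simpa only [(hσ k).right] using (hk _ ⟨dist_nonneg, le_rfl⟩).le
  choose α hα using fun k => KobayashiSpace.isGeodesicSpace D z₀ (x k)
  choose β hβ using fun k => KobayashiSpace.isGeodesicSpace D z₀ (y k)
  obtain ⟨φ, hφ, η, hη⟩ := exists_subseq_geodesicRay_of_segments hα hx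
  obtain ⟨ψ, hψ, θ, hθ⟩ := exists_subseq_geodesicRay_of_segments (fun k => hβ (φ k))
    (hy.comp hφ.tendsto_atTop)
  have hφψ := (hφ.comp hψ).tendsto_atTop
  have hη_lim : ∀ t, 0 ≤ t → Tendsto (fun j => α (φ (ψ j)) t) atTop (𝓝 (η.curve t)) :=
    fun t ht => ((hη t).tendsto_at ⟨ht, le_rfl⟩).comp hψ.tendsto_atTop
  have hθ_lim : ∀ t, 0 ≤ t → Tendsto (fun j => β (φ (ψ j)) t) atTop (𝓝 (θ.curve t)) :=
    fun t ht => (hθ t).tendsto_at ⟨ht, le_rfl⟩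
  have hηθ : η.toBoundary = θ.toBoundary :=
    GeodesicRay.toBoundary_eq_iff.2 ⟨2 * δ, fun t ht => hδ.dist_limit_le_two_mul
      (fun j => hα (φ (ψ j))) (fun j => hβ (φ (ψ j))) (fun j => hσ (φ (ψ j)))
      (fun r => hφψ.eventually (hfar r)) ht (hη_lim t ht) (hθ_lim t ht)⟩
  refine ⟨φ ∘ ψ, hφ.comp hψ, η.toBoundary, ?_, hηθ ▸ ?_⟩
  · exact pointsConverge_of_tendsto hδ (fun j => hα (φ (ψ j))) (hx.comp hφψ) hη_lim
  · exact pointsConverge_of_tendsto hδ (fun j => hβ (φ (ψ j))) (hy.comp hφψ) hθ_lim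

end Proper

end GromovCompactification

/-! ### Visibility and end points of geodesics -/

lemma tendsto_of_forall_subseq_limit_eq {X : Type*} [TopologicalSpace X] [FirstCountableTopology X]
    {K : Set X} (hK : IsCompact K) {u : ℕ → X} {p : X} (hu : ∀ k, u k ∈ K)
    (h : ∀ φ : ℕ → ℕ, StrictMono φ → ∀ q ∈ K, Tendsto (fun j => u (φ j)) atTop (𝓝 q) → q = p) :
    Tendsto u atTop (𝓝 p) :=
  hK.tendsto_nhds_of_unique_mapClusterPt (Eventually.of_forall hu) fun q hq hqu =>
    let ⟨φ, hφ, hlim⟩ := hqu.tendsto_subseq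
    h φ hφ q hq hlim

section Visibility

variable {n : ℕ} {D : Set (CSpace n)}

lemma IsBoundedDomain.isCompact_closure [IsBoundedDomain D] : IsCompact (closure D) :=
  (IsBoundedDomain.isBounded (D := D)).isCompact_closure

/-- Every ray in the class `τ` lands at the point `p` of `ℂⁿ`. -/
def GromovBoundary.HasEndpoint {z₀ : KobayashiSpace D} (τ : GromovBoundary D z₀) (p : CSpace n) :
    Prop :=
  ∀ η : GeodesicRay D z₀, η.toBoundary = τ → Tendsto (fun t => (η.curve t : CSpace n)) atTop (𝓝 p)

namespace HasVisibilityProperty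

variable [IsBoundedDomain D] (hD : HasVisibilityProperty D) {p q : CSpace n}
include hD

lemma eq_of_far_geodesics (hp : p ∈ frontier D) (hq : q ∈ frontier D) (o : KobayashiSpace D)
    (h : ∀ U ∈ 𝓝 p, ∀ V ∈ 𝓝 q, ∀ r, ∃ (a b : ℝ) (γ : ℝ → KobayashiSpace D), a ≤ b ∧
      IsometryOn γ (Icc a b) ∧ (γ a : CSpace n) ∈ U ∧ (γ b : CSpace n) ∈ V ∧
        ∀ s ∈ Icc a b, r < dist o (γ s)) : p = q := by
  by_contra hpq
  obtain ⟨U, hU, V, hV, -, K, hK, hKD, hvis⟩ := hD p hp q hq hpq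
  have hK' : IsCompact ((fun x : KobayashiSpace D => (x : CSpace n)) ⁻¹' K) :=
    (KobayashiSpace.isOpenEmbedding_coe D).isInducing.isCompact_preimage' hK
      (hKD.trans Subtype.range_coe.ge)
  obtain ⟨r, hr⟩ := hK'.isBounded.subset_closedBall o
  obtain ⟨a, b, γ, hab, hγ, ha, hb, hfar⟩ := h U hU V hV r
  have hmaps : MapsTo (fun t => a + t) (Icc 0 (b - a)) (Icc a b) := fun t ht =>
    ⟨by linarith [ht.1], by linarith [ht.2]⟩
  obtain ⟨_, ⟨s, hs, rfl⟩, hsK⟩ := hvis (b - a) (fun t => γ (a + t)) (sub_nonneg.2 hab)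
    (isGeodesicOn_coe_iff.2 (hγ.comp (isometry_add_left a) hmaps)) (by rwa [add_zero])
    (by rwa [add_sub_cancel])
  exact (hfar _ (hmaps hs)).not_ge (Metric.mem_closedBall'.1 (hr hsK))

lemma eq_of_mapClusterPt (hp : p ∈ frontier D) (hq : q ∈ frontier D)
    {γ : ℕ → ℝ → KobayashiSpace D} {g : ℝ → KobayashiSpace D}
    (hg : ∀ t, 0 ≤ t → Tendsto (fun k => γ k t) atTop (𝓝 (g t)))
    (hpg : MapClusterPt p atTop fun t => (g t : CSpace n))
    (hqγ : ∀ V ∈ 𝓝 q, ∀ T, ∀ᶠ k in atTop, ∃ b ≥ T, IsometryOn (γ k) (Icc 0 b) ∧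
      (γ k b : CSpace n) ∈ V) : p = q := by
  refine hD.eq_of_far_geodesics hp hq (g 0) fun U hU V hV r => ?_
  obtain ⟨T, hTU, hT⟩ := ((hpg.frequently (interior_mem_nhds.2 hU)).and_eventually
    (eventually_gt_atTop (max 0 (r + 1)))).exists
  obtain ⟨hT₀, hTr⟩ := max_lt_iff.1 hT
  have hTU' : ∀ᶠ k in atTop, (γ k T : CSpace n) ∈ U :=
    (KobayashiSpace.tendsto_coe_iff.2 (hg T hT₀.le)).eventually
      (mem_interior_iff_mem_nhds.1 hTU)
  have hγ₀ : ∀ᶠ k in atTop, dist (γ k 0) (g 0) < 1 :=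
    (hg 0 le_rfl).eventually_mem (Metric.ball_mem_nhds _ one_pos)
  obtain ⟨k, hkU, hk₀, b, hTb, hγ, hbV⟩ := (hTU'.and (hγ₀.and (hqγ V hV T))).exists
  refine ⟨T, b, γ k, hTb, hγ.mono (Icc_subset_Icc_left hT₀.le), hkU, hbV, fun s hs => ?_⟩
  have hs₀ : 0 ≤ s := hT₀.le.trans hs.1
  have hγs : dist (γ k 0) (γ k s) = s := by
    rw [hγ 0 ⟨le_rfl, hs₀.trans hs.2⟩ s ⟨hs₀, hs.2⟩, dist_comm, Real.dist_0_eq_abs,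
      abs_of_nonneg hs₀]
  linarith [dist_triangle (γ k 0) (g 0) (γ k s), hs.1]

theorem exists_tendsto_of_ray {g : ℝ → KobayashiSpace D} (hg : IsometryOn g (Ici 0)) :
    ∃ p ∈ frontier D, Tendsto (fun t => (g t : CSpace n)) atTop (𝓝 p) := by
  have hcl : ∀ᶠ t in atTop, (g t : CSpace n) ∈ closure D :=
    Eventually.of_forall fun t => subset_closure (g t).2
  have hfr : ∀ p, MapClusterPt p atTop (fun t => (g t : CSpace n)) → p ∈ frontier D :=
    fun p hp => by
      obtain ⟨𝒰, h𝒰, hlim⟩ := mapClusterPt_iff_ultrafilter.1 hp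
      exact KobayashiSpace.mem_frontier_of_tendsto ((hg.tendsto_dist_atTop (g 0)).mono_left h𝒰)
        hlim
  have hcompact := IsBoundedDomain.isCompact_closure (D := D)
  obtain ⟨p, -, hp⟩ := hcompact.exists_mapClusterPt_of_frequently hcl.frequently
  refine ⟨p, hfr p hp, hcompact.tendsto_nhds_of_unique_mapClusterPt hcl fun q _ hq => ?_⟩
  refine hD.eq_of_mapClusterPt (hfr q hq) (hfr p hp) (γ := fun _ => g)
    (fun _ _ => tendsto_const_nhds) hq fun V hV T => Eventually.of_forall fun _ => ?_
  obtain ⟨b, hb, hTb⟩ := ((hp.frequently hV).and_eventually (eventually_ge_atTop T)).exists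
  exact ⟨b, hTb, hg.mono Icc_subset_Ici_self, hb⟩

variable [ProperSpace (KobayashiSpace D)] {z₀ : KobayashiSpace D} {γ η : GeodesicRay D z₀}

lemma eq_of_toBoundary_eq (h : γ.toBoundary = η.toBoundary)
    (hp : p ∈ frontier D) (hq : q ∈ frontier D)
    (hγ : Tendsto (fun t => (γ.curve t : CSpace n)) atTop (𝓝 p))
    (hη : Tendsto (fun t => (η.curve t : CSpace n)) atTop (𝓝 q)) : p = q := by
  obtain ⟨M, hM⟩ := GeodesicRay.toBoundary_eq_iff.1 h
  refine hD.eq_of_far_geodesics hp hq z₀ fun U hU V hV r => ?_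
  obtain ⟨t, hUt, hVt, ht⟩ := ((hγ.eventually_mem hU).and ((hη.eventually_mem hV).and
    (eventually_gt_atTop (max 0 (r + M))))).exists
  obtain ⟨ht₀, htr⟩ := max_lt_iff.1 ht
  obtain ⟨σ, hσ⟩ := KobayashiSpace.isGeodesicSpace D (γ.curve t) (η.curve t)
  refine ⟨0, _, σ, dist_nonneg, hσ.isometryOn, hσ.left.symm ▸ hUt, hσ.right.symm ▸ hVt,
    fun s hs => ?_⟩
  have htriangle := dist_triangle_right z₀ (γ.curve t) (σ s)
  rw [γ.dist_curve ht₀.le, hσ.dist_left hs] at htriangle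
  linarith [hs.2, hM t ht₀.le]

theorem exists_hasEndpoint (τ : GromovBoundary D z₀) :
    ∃ p ∈ frontier D, τ.HasEndpoint p := by
  obtain ⟨γ, rfl⟩ := Quotient.exists_rep τ
  obtain ⟨p, hp, hγ⟩ := hD.exists_tendsto_of_ray γ.isometryOn_curve
  refine ⟨p, hp, fun η hη => ?_⟩
  obtain ⟨q, hq, hηq⟩ := hD.exists_tendsto_of_ray η.isometryOn_curve
  rwa [← hD.eq_of_toBoundary_eq hη hq hp hηq hγ]

variable {τ : GromovBoundary D z₀}

theorem tendsto_of_pointsConverge {z : ℕ → KobayashiSpace D}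
    (hz : PointsConverge z τ) (hp : p ∈ frontier D) (hτ : τ.HasEndpoint p) :
    Tendsto (fun k => (z k : CSpace n)) atTop (𝓝 p) := by
  refine tendsto_of_forall_subseq_limit_eq IsBoundedDomain.isCompact_closure
    (fun k => subset_closure (z k).2) fun φ hφ q _ hq => ?_
  choose α hα using fun k => KobayashiSpace.isGeodesicSpace D z₀ (z k)
  obtain ⟨ψ, hψ, hR, η, hη, hlim⟩ := hz.exists_subseq hα hφ
  have hqψ := hq.comp hψ.tendsto_atTop
  refine (hD.eq_of_mapClusterPt hp (KobayashiSpace.mem_frontier_of_tendsto hR hqψ) hlim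
    (hτ η hη).mapClusterPt fun V hV T => ?_).symm
  filter_upwards [hR.eventually_ge_atTop T, hqψ.eventually_mem hV] with j hjT hjV
  exact ⟨_, hjT, (hα _).isometryOn, (hα _).right.symm ▸ hjV⟩

omit [ProperSpace (KobayashiSpace D)] in
theorem tendsto_of_classesConverge {s : ℕ → GromovBoundary D z₀} (hs : ClassesConverge s τ)
    {e : GromovBoundary D z₀ → CSpace n} (he : ∀ σ, e σ ∈ frontier D)
    (hlim : ∀ σ : GromovBoundary D z₀, σ.HasEndpoint (e σ)) :
    Tendsto (fun k => e (s k)) atTop (𝓝 (e τ)) := by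
  refine tendsto_of_forall_subseq_limit_eq IsBoundedDomain.isCompact_closure
    (fun k => frontier_subset_closure (he _)) fun φ hφ q _ hq => ?_
  choose γ hγ using fun k => Quotient.exists_rep (s k)
  obtain rfl : (fun k => (γ k).toBoundary) = s := funext hγ
  obtain ⟨ψ, hψ, η, hη, hηlim⟩ := hs.exists_subseq hφ
  have hqfr : q ∈ frontier D :=
    isClosed_frontier.mem_of_tendsto hq (Eventually.of_forall fun _ => he _)
  refine (hD.eq_of_mapClusterPt (he τ) hqfr hηlim (hlim τ η hη).mapClusterPt
    fun V hV T => ?_).symm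
  filter_upwards [(hq.comp hψ.tendsto_atTop).eventually_mem (interior_mem_nhds.2 hV)] with j hj
  obtain ⟨b, hbV, hTb⟩ := (((hlim _ _ (rfl : (γ (φ (ψ j))).toBoundary = _)).eventually_mem
    (mem_interior_iff_mem_nhds.1 hj)).and (eventually_ge_atTop T)).exists
  exact ⟨b, hTb, (γ _).isometryOn_curve.mono Icc_subset_Ici_self, hbV⟩

end HasVisibilityProperty

end Visibility

/-! ### Extensions of the identity map -/

lemma isClosedMap_of_countablyCompactSpace {X Y : Type*} [TopologicalSpace X]
    [CountablyCompactSpace X] [UniformSpace Y] [(uniformity Y).IsCountablyGenerated] [T2Space Y]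
    {f : X → Y} (hf : Continuous f) : IsClosedMap f := fun _ hC =>
  (hC.isCountablyCompact.image hf).isSeqCompact.isCompact.isClosed

section Extension

variable {n : ℕ} {D : Set (CSpace n)} [IsBoundedDomain D]

section Compactness

variable [ProperSpace (KobayashiSpace D)] {z₀ : D} {δ : ℝ}
  (hδ : HasSlimTriangles (KobayashiSpace D) δ)
include hδ

namespace GromovCompactification

lemma exists_subseq_tendsto_inner (z : ℕ → D) :
    ∃ a : GromovCompactification D z₀, ∃ φ : ℕ → ℕ, StrictMono φ ∧
      Tendsto (fun j => inner (z (φ j))) atTop (𝓝 a) := by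
  let w : ℕ → KobayashiSpace D := z
  let o : KobayashiSpace D := z₀
  by_cases hw : Tendsto (fun k => dist o (w k)) atTop atTop
  · obtain ⟨φ, hφ, σ, hσ⟩ := exists_subseq_pointsConverge hδ hw
    exact ⟨ideal σ, φ, hφ, PointsConverge.tendsto hσ⟩
  · obtain ⟨r, hr⟩ := not_forall.1 (mt tendsto_atTop.2 hw)
    obtain ⟨x, -, φ, hφ, hx⟩ := tendsto_subseq_of_frequently_bounded
      (Metric.isBounded_closedBall (x := o) (r := r))
      ((not_eventually.1 hr).mono fun k hk => Metric.mem_closedBall'.2 (le_of_not_ge hk))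
    exact ⟨inner x, φ, hφ, (continuous_inner.tendsto x).comp hx⟩

theorem seqCompactSpace : SeqCompactSpace (GromovCompactification D z₀) := by
  refine ⟨fun y _ => ?_⟩
  have hcases : ∃ᶠ k in atTop, (∃ z, y k = inner z) ∨ ∃ s, y k = ideal s :=
    Frequently.of_forall fun k => by
      cases y k with
      | inner z => exact Or.inl ⟨z, rfl⟩
      | ideal s => exact Or.inr ⟨s, rfl⟩
  suffices ∃ a, ∃ φ : ℕ → ℕ, StrictMono φ ∧ Tendsto (y ∘ φ) atTop (𝓝 a) by simpa using this
  rcases frequently_or_distrib.1 hcases with h | h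
  · obtain ⟨φ, hφ, hy⟩ := extraction_of_frequently_atTop h
    choose z hz using hy
    obtain ⟨a, ψ, hψ, ha⟩ := exists_subseq_tendsto_inner hδ z
    exact ⟨a, φ ∘ ψ, hφ.comp hψ, ha.congr fun j => (hz (ψ j)).symm⟩
  · obtain ⟨φ, hφ, hy⟩ := extraction_of_frequently_atTop h
    choose s hs using hy
    obtain ⟨ψ, hψ, σ, hσ⟩ := exists_subseq_classesConverge hδ s
    exact ⟨ideal σ, φ ∘ ψ, hφ.comp hψ,
      (ClassesConverge.tendsto hσ).congr fun j => (hs (ψ j)).symm⟩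

theorem isClosedMap_of_continuous {Φ : GromovCompactification D z₀ → closure D}
    (hΦ : Continuous Φ) : IsClosedMap Φ :=
  have := seqCompactSpace hδ (z₀ := z₀)
  isClosedMap_of_countablyCompactSpace hΦ

theorem surjective_of_continuous {Φ : GromovCompactification D z₀ → closure D}
    (hΦ : Continuous Φ) (hid : ∀ z : D, (Φ (inner z) : CSpace n) = z) : Function.Surjective Φ := by
  have hD : DenseRange (inclusion (subset_closure (s := D))) :=
    (denseRange_inclusion_iff subset_closure).2 subset_rfl
  have hrange : range (inclusion (subset_closure (s := D))) ⊆ range Φ := by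
    rintro _ ⟨z, rfl⟩
    exact ⟨inner z, Subtype.ext (hid z)⟩
  rw [← range_eq_univ, ← (isClosedMap_of_continuous hδ hΦ).isClosed_range.closure_eq]
  exact (hD.mono hrange).closure_eq

end GromovCompactification

open GromovCompactification in
theorem HasVisibilityProperty.exists_extension (hD : HasVisibilityProperty D) :
    ∃ Φ : GromovCompactification D z₀ → closure D, IsContinuousSurjectiveExtension Φ := by
  choose e he hlim using hD.exists_hasEndpoint (z₀ := z₀)
  let Φ : GromovCompactification D z₀ → closure D := fun x => match x with
    | .inner z => inclusion subset_closure z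
    | .ideal σ => ⟨e σ, frontier_subset_closure (he σ)⟩
  have hΦ : Continuous Φ := continuous_of_tendsto (continuous_inclusion subset_closure)
    (fun _ σ hz => tendsto_subtype_rng.2 (hD.tendsto_of_pointsConverge hz (he σ) (hlim σ)))
    (fun _ _ hs => tendsto_subtype_rng.2 (hD.tendsto_of_classesConverge hs he hlim))
  exact ⟨Φ, hΦ, surjective_of_continuous hδ hΦ fun _ => rfl, fun _ => rfl⟩

end Compactness

variable {p q : CSpace n}

section Escape

variable [ProperSpace (KobayashiSpace D)] (hpq : p ≠ q) (h : ¬ HasVisibleGeodesics D p q)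
  (o : KobayashiSpace D)
include hpq h

lemma exists_far_geodesic_of_not_hasVisibleGeodesics {U V : Set (CSpace n)} (hU : U ∈ 𝓝 p)
    (hV : V ∈ 𝓝 q) (r : ℝ) :
    ∃ (x y : KobayashiSpace D) (σ : ℝ → KobayashiSpace D), IsGeodesicSegment x y σ ∧
      (x : CSpace n) ∈ U ∧ (y : CSpace n) ∈ V ∧ ∀ s ∈ Icc 0 (dist x y), r < dist o (σ s) := by
  by_contra! hnear
  obtain ⟨U', hU', V', hV', hdisj⟩ := exists_nhds_disjoint_closure hpq
  have hdisj' : Disjoint (closure (U ∩ U')) (closure (V ∩ V')) :=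
    hdisj.mono (closure_mono inter_subset_right) (closure_mono inter_subset_right)
  refine h ⟨U ∩ U', inter_mem hU hU', V ∩ V', inter_mem hV hV', hdisj'.inter_eq,
    (fun x : KobayashiSpace D => (x : CSpace n)) '' Metric.closedBall o r,
    (isCompact_closedBall o r).image (KobayashiSpace.isOpenEmbedding_coe D).continuous,
    image_subset_iff.2 fun x _ => x.2, fun L γ hL hγ hγ₀ hγL => ?_⟩
  let x : KobayashiSpace D := ⟨γ 0, hγ.1 ⟨le_rfl, hL⟩⟩
  let y : KobayashiSpace D := ⟨γ L, hγ.1 ⟨hL, le_rfl⟩⟩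
  have hjoin : IsGeodesicJoining D x y L γ := ⟨hL, hγ, rfl, rfl⟩
  obtain ⟨σ, hσ, hσγ⟩ := hjoin.exists_isGeodesicSegment_eqOn
  obtain ⟨s, hs, hsr⟩ := hnear x y σ hσ hγ₀.1 hγL.1
  rw [← hjoin.length_eq] at hs
  exact ⟨γ s, mem_image_of_mem γ hs, σ s, Metric.mem_closedBall'.2 hsr, hσγ hs⟩

lemma exists_seq_far_geodesic_of_not_hasVisibleGeodesics :
    ∃ (x y : ℕ → KobayashiSpace D) (σ : ℕ → ℝ → KobayashiSpace D),
      (∀ k, IsGeodesicSegment (x k) (y k) (σ k)) ∧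
      Tendsto (fun k => (x k : CSpace n)) atTop (𝓝 p) ∧
      Tendsto (fun k => (y k : CSpace n)) atTop (𝓝 q) ∧
      ∀ r, ∀ᶠ k in atTop, ∀ s ∈ Icc 0 (dist (x k) (y k)), r < dist o (σ k s) := by
  obtain ⟨U, hU⟩ := (𝓝 p).exists_antitone_basis
  obtain ⟨V, hV⟩ := (𝓝 q).exists_antitone_basis
  choose x y σ hσ hx hy hfar using fun k : ℕ =>
    exists_far_geodesic_of_not_hasVisibleGeodesics hpq h o (hU.mem k) (hV.mem k) k
  refine ⟨x, y, σ, hσ, hU.tendsto hx, hV.tendsto hy, fun r => ?_⟩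
  filter_upwards [tendsto_natCast_atTop_atTop.eventually_ge_atTop r] with k hk s hs
  exact hk.trans_lt (hfar k s hs)

end Escape

namespace IsContinuousSurjectiveExtension

variable {z₀ : D} {Φ : GromovCompactification D z₀ → closure D}
  (hΦ : IsContinuousSurjectiveExtension Φ) {δ : ℝ} {σ : GromovBoundary D z₀}
include hΦ

omit [IsBoundedDomain D] in
lemma tendsto_of_pointsConverge {z : ℕ → D} (hz : PointsConverge z σ) :
    Tendsto (fun k => (z k : CSpace n)) atTop
      (𝓝 (Φ (GromovCompactification.ideal σ) : CSpace n)) :=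
  ((continuous_subtype_val.comp hΦ.1).tendsto _ |>.comp hz.tendsto).congr fun k => hΦ.2.2 (z k)

variable [ProperSpace (KobayashiSpace D)] (hδ : HasSlimTriangles (KobayashiSpace D) δ)
include hδ

theorem hasVisibilityProperty : HasVisibilityProperty D := by
  intro p _ q _ hpq
  by_contra h
  obtain ⟨x, y, σ, hσ, hxp, hyq, hfar⟩ :=
    exists_seq_far_geodesic_of_not_hasVisibleGeodesics hpq h z₀
  obtain ⟨φ, hφ, τ, hx, hy⟩ := exists_subseq_pointsConverge_pair hδ hσ hfar
  have hp := tendsto_nhds_unique (hxp.comp hφ.tendsto_atTop) (hΦ.tendsto_of_pointsConverge hx)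
  have hq := tendsto_nhds_unique (hyq.comp hφ.tendsto_atTop) (hΦ.tendsto_of_pointsConverge hy)
  exact hpq (hp.trans hq.symm)

lemma hasEndpoint (σ : GromovBoundary D z₀) :
    GromovBoundary.HasEndpoint σ (Φ (GromovCompactification.ideal σ) : CSpace n) := by
  obtain ⟨p, -, hp⟩ := (hΦ.hasVisibilityProperty hδ).exists_hasEndpoint σ
  obtain ⟨η, rfl⟩ := Quotient.exists_rep σ
  have hcast := tendsto_natCast_atTop_atTop (R := ℝ)
  have hη : PointsConverge (fun k : ℕ => η.curve k) η.toBoundary :=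
    pointsConverge_of_tendsto hδ (fun k => η.isGeodesicSegment_curve k.cast_nonneg)
      ((η.isometryOn_curve.tendsto_dist_atTop z₀).comp hcast) fun _ _ => tendsto_const_nhds
  have heq := tendsto_nhds_unique ((hp η rfl).comp hcast) (hΦ.tendsto_of_pointsConverge hη)
  exact heq ▸ hp

end IsContinuousSurjectiveExtension

end Extension

/-! ### Geodesic loops -/

section GeodesicLoops

variable {n : ℕ} {D : Set (CSpace n)} {p : CSpace n}

lemma clusterSet_eq_singleton {l : Filter ℝ} [l.NeBot] {g : ℝ → CSpace n}
    (hp : p ∈ closure D) (h : Tendsto g l (𝓝 p)) : clusterSet D l g = {p} := by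
  refine Subset.antisymm (fun q hq => ?_) (singleton_subset_iff.2 ⟨hp, h.mapClusterPt⟩)
  have : (𝓝 q ⊓ 𝓝 p).NeBot := NeBot.mono hq.2 (inf_le_inf_left _ h)
  exact eq_of_nhds_neBot this

variable [IsBoundedDomain D]

lemma HasVisibilityProperty.exists_tendsto_of_line (hD : HasVisibilityProperty D)
    {ℓ : ℝ → KobayashiSpace D} (hℓ : IsometryOn ℓ univ) :
    ∃ p ∈ frontier D, ∃ q ∈ frontier D, Tendsto (fun t => (ℓ t : CSpace n)) atTop (𝓝 p) ∧
      Tendsto (fun t => (ℓ t : CSpace n)) atBot (𝓝 q) := by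
  obtain ⟨p, hp, hℓp⟩ := hD.exists_tendsto_of_ray (hℓ.mono (subset_univ _))
  obtain ⟨q, hq, hℓq⟩ := hD.exists_tendsto_of_ray
    (hℓ.comp (IsometryEquiv.neg ℝ).isometry fun _ _ => mem_univ _)
  refine ⟨p, hp, q, hq, hℓp, (hℓq.comp tendsto_neg_atBot_atTop).congr fun t => ?_⟩
  exact congrArg (fun s => (ℓ s : CSpace n)) (neg_neg t)

lemma HasVisibilityProperty.isGeodesicLoop_iff (hD : HasVisibilityProperty D)
    {ℓ : ℝ → KobayashiSpace D} (hℓ : IsometryOn ℓ univ) :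
    IsGeodesicLoop D (fun t => ℓ t) ↔ ∃ p ∈ frontier D,
      Tendsto (fun t => (ℓ t : CSpace n)) atTop (𝓝 p) ∧
      Tendsto (fun t => (ℓ t : CSpace n)) atBot (𝓝 p) := by
  constructor
  · rintro ⟨-, hcluster⟩
    obtain ⟨p, hp, q, hq, hℓp, hℓq⟩ := hD.exists_tendsto_of_line hℓ
    rw [clusterSet_eq_singleton (frontier_subset_closure hp) hℓp,
      clusterSet_eq_singleton (frontier_subset_closure hq) hℓq, singleton_eq_singleton_iff]
      at hcluster
    exact ⟨p, hp, hℓp, hcluster ▸ hℓq⟩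
  · rintro ⟨p, hp, hℓp, hℓq⟩
    refine ⟨isGeodesicOn_coe_iff.2 hℓ, ?_⟩
    rw [clusterSet_eq_singleton (frontier_subset_closure hp) hℓp,
      clusterSet_eq_singleton (frontier_subset_closure hp) hℓq]

section Boundary

variable {z₀ : KobayashiSpace D} {τ τ' : GromovBoundary D z₀}

lemma GromovBoundary.HasEndpoint.mem_frontier (hτ : τ.HasEndpoint p) : p ∈ frontier D := by
  obtain ⟨η, hη⟩ := Quotient.exists_rep τ
  exact KobayashiSpace.mem_frontier_of_tendsto (η.isometryOn_curve.tendsto_dist_atTop z₀) (hτ η hη)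

variable [ProperSpace (KobayashiSpace D)]

theorem PointsConverge.ne_of_dist_add_dist_eq {x y : ℕ → KobayashiSpace D} {w : KobayashiSpace D}
    (hx : PointsConverge x τ) (hy : PointsConverge y τ')
    (hw : ∀ j k, dist (x j) w + dist w (y k) = dist (x j) (y k)) : τ ≠ τ' := by
  rintro rfl
  choose α hα using fun k => KobayashiSpace.isGeodesicSpace D z₀ (x k)
  choose β hβ using fun k => KobayashiSpace.isGeodesicSpace D z₀ (y k)
  obtain ⟨φ, -, hx_far, η, hη, hαη⟩ := hx.exists_subseq hα strictMono_id
  obtain ⟨ψ, -, hy_far, θ, hθ, hβθ⟩ := hy.exists_subseq hβ strictMono_id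
  obtain ⟨M, hM⟩ := GeodesicRay.toBoundary_eq_iff.1 (hη.trans hθ.symm)
  have hM₀ : 0 ≤ M := dist_nonneg.trans (hM 0 le_rfl)
  obtain ⟨T, hT, hMT⟩ : ∃ T, 0 ≤ T ∧ M < 2 * (T - dist z₀ w) :=
    ⟨dist z₀ w + M / 2 + 1, by positivity, by linarith⟩
  have hlim : 2 * (T - dist z₀ w) ≤ dist (η.curve T) (θ.curve T) := by
    refine ge_of_tendsto ((hαη T hT).dist (hβθ T hT)) ?_
    filter_upwards [hx_far.eventually_ge_atTop T, hy_far.eventually_ge_atTop T] with j hjx hjy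
    exact (hα _).two_mul_sub_le_dist (hβ _) (hw _ _) ⟨hT, hjx⟩ ⟨hT, hjy⟩
  linarith [hM T hT]

theorem HasVisibilityProperty.exists_isGeodesicLoop (hD : HasVisibilityProperty D) {δ : ℝ}
    (hδ : HasSlimTriangles (KobayashiSpace D) δ) (hne : τ ≠ τ') (hτ : τ.HasEndpoint p)
    (hτ' : τ'.HasEndpoint p) : ∃ g, IsGeodesicLoop D g := by
  have hp := hτ.mem_frontier
  obtain ⟨η, rfl⟩ := Quotient.exists_rep τ
  obtain ⟨θ, rfl⟩ := Quotient.exists_rep τ'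
  obtain ⟨T, hT, hdiv⟩ : ∃ T, 0 ≤ T ∧ 2 * δ < dist (η.curve T) (θ.curve T) := by
    by_contra! hclose
    exact hne (GeodesicRay.toBoundary_eq_iff.2 ⟨2 * δ, hclose⟩)
  obtain ⟨f, ℓ, m, a, b, hℓ, hfℓ, hf, hm, ha, hb⟩ := hδ.exists_line_tendsto
    (KobayashiSpace.isGeodesicSpace D) η.isometryOn_curve θ.isometryOn_curve
    (η.curve_zero.trans θ.curve_zero.symm) hT hdiv
  have hηp := (hτ η rfl).comp hm
  have hθp := (hτ' θ rfl).comp hm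
  obtain ⟨q, hq, q', hq', hℓq, hℓq'⟩ := hD.exists_tendsto_of_line hℓ
  have hqp : q = p := by
    refine hD.eq_of_mapClusterPt hq hp (fun t _ => hfℓ t) hℓq.mapClusterPt fun V hV R => ?_
    filter_upwards [ha.eventually_ge_atTop 0, hb.eventually_ge_atTop R, hθp.eventually_mem hV]
      with j haj hbj hjV
    exact ⟨b j, hbj, (hf j).1.mono (Icc_subset_Icc_left (neg_nonpos.2 haj)),
      (hf j).2.2.symm ▸ hjV⟩
  have hqp' : q' = p := by
    refine hD.eq_of_mapClusterPt hq' hp (γ := fun j t => f j (-t)) (fun t _ => hfℓ (-t))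
      (hℓq'.comp tendsto_neg_atTop_atBot).mapClusterPt fun V hV R => ?_
    filter_upwards [hb.eventually_ge_atTop 0, ha.eventually_ge_atTop R, hηp.eventually_mem hV]
      with j hbj haj hjV
    exact ⟨a j, haj, (hf j).1.comp (IsometryEquiv.neg ℝ).isometry
      fun t ht => ⟨neg_le_neg ht.2, (neg_nonpos.2 ht.1).trans hbj⟩, (hf j).2.1.symm ▸ hjV⟩
  exact ⟨_, (hD.isGeodesicLoop_iff hℓ).2 ⟨p, hp, hqp ▸ hℓq, hqp' ▸ hℓq'⟩⟩

end Boundary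

namespace IsContinuousSurjectiveExtension

variable [ProperSpace (KobayashiSpace D)] {z₀ : D} {Φ : GromovCompactification D z₀ → closure D}
  (hΦ : IsContinuousSurjectiveExtension Φ) {δ : ℝ} (hδ : HasSlimTriangles (KobayashiSpace D) δ)
include hΦ hδ

theorem hasNoGeodesicLoops (hinj : Function.Injective Φ) : HasNoGeodesicLoops D := by
  rintro ⟨g, hg⟩
  obtain ⟨ℓ, hℓ, hℓg⟩ := hg.1.exists_isometryOn_eqOn univ_nonempty
  obtain rfl : (fun t => (ℓ t : CSpace n)) = g := funext fun t => hℓg (mem_univ t)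
  obtain ⟨p, hp, hℓp, hℓp'⟩ := ((hΦ.hasVisibilityProperty hδ).isGeodesicLoop_iff hℓ).1 hg
  have hpD : p ∉ D := ((IsBoundedDomain.isOpen (D := D)).frontier_eq ▸ hp).2
  have hcast := tendsto_natCast_atTop_atTop (R := ℝ)
  have hxp : Tendsto (fun k : ℕ => (ℓ k : CSpace n)) atTop (𝓝 p) := hℓp.comp hcast
  have hyp : Tendsto (fun k : ℕ => (ℓ (-k) : CSpace n)) atTop (𝓝 p) :=
    hℓp'.comp (tendsto_neg_atTop_atBot.comp hcast)
  obtain ⟨φ, hφ, τ, hτ⟩ := exists_subseq_pointsConverge hδ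
    (KobayashiSpace.tendsto_dist_atTop z₀ hpD hxp)
  obtain ⟨ψ, hψ, τ', hτ'⟩ := exists_subseq_pointsConverge hδ
    (KobayashiSpace.tendsto_dist_atTop z₀ hpD hyp)
  refine PointsConverge.ne_of_dist_add_dist_eq (w := ℓ 0) hτ hτ' (fun j k => ?_) ?_
  · have hj : (0 : ℝ) ≤ φ j := Nat.cast_nonneg _
    have hk : (0 : ℝ) ≤ ψ k := Nat.cast_nonneg _
    rw [hℓ _ trivial _ trivial, hℓ _ trivial _ trivial, hℓ _ trivial _ trivial]
    simp only [Real.dist_eq, sub_zero, sub_neg_eq_add, zero_add, abs_of_nonneg, hj, hk,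
      add_nonneg]
  · have hτp := tendsto_nhds_unique (hΦ.tendsto_of_pointsConverge hτ) (hxp.comp hφ.tendsto_atTop)
    have hτp' := tendsto_nhds_unique (hΦ.tendsto_of_pointsConverge hτ')
      (hyp.comp hψ.tendsto_atTop)
    exact GromovCompactification.ideal.inj (hinj (Subtype.ext (hτp.trans hτp'.symm)))

theorem injective (hloop : HasNoGeodesicLoops D) : Function.Injective Φ := by
  have hideal (z : D) (σ : GromovBoundary D z₀) :
      Φ (GromovCompactification.inner z) ≠ Φ (GromovCompactification.ideal σ) := fun h => by
    have hσ := (hΦ.hasEndpoint hδ σ).mem_frontier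
    rw [(IsBoundedDomain.isOpen (D := D)).frontier_eq, ← h, hΦ.2.2 z] at hσ
    exact hσ.2 z.2
  rintro (z | σ) (z' | σ') h
  · exact congrArg _ (Subtype.ext ((hΦ.2.2 z).symm.trans ((congrArg _ h).trans (hΦ.2.2 z'))))
  · exact (hideal z σ' h).elim
  · exact (hideal z' σ h.symm).elim
  · by_contra hne
    exact hloop ((hΦ.hasVisibilityProperty hδ).exists_isGeodesicLoop hδ
      (fun hσ => hne (congrArg _ hσ)) (hΦ.hasEndpoint hδ σ) (h ▸ hΦ.hasEndpoint hδ σ'))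

end IsContinuousSurjectiveExtension

end GeodesicLoops

theorem mainTheorem5 {n : ℕ} (D : Set (CSpace n)) (hD_open : IsOpen D) (hD_conn : IsConnected D)
    (hD_bdd : Bornology.IsBounded D) (hD_complete : IsCompleteHyperbolic D)
    (hD_gromov : IsGromovHyperbolic D) (z₀ : D) :
    (HasVisibilityProperty D ↔
      ∃ Φ : GromovCompactification D z₀ → closure D, IsContinuousSurjectiveExtension Φ) ∧
    (∀ Φ : GromovCompactification D z₀ → closure D, IsContinuousSurjectiveExtension Φ →
      (IsHomeomorph Φ ↔ HasNoGeodesicLoops D)) := by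
  have : IsBoundedDomain D := ⟨hD_open, hD_conn.isPreconnected, hD_bdd⟩
  have := KobayashiSpace.properSpace hD_complete
  obtain ⟨δ, hδ⟩ := hD_gromov.exists_hasSlimTriangles
  refine ⟨⟨fun hD => hD.exists_extension hδ, ?_⟩, fun Φ hΦ => ⟨fun h => ?_, fun hloop => ?_⟩⟩
  · rintro ⟨Φ, hΦ⟩
    exact hΦ.hasVisibilityProperty hδ
  · exact hΦ.hasNoGeodesicLoops hδ h.injective
  · exact isHomeomorph_iff_continuous_isClosedMap_bijective.2
      ⟨hΦ.1, GromovCompactification.isClosedMap_of_continuous hδ hΦ.1,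
        hΦ.injective hδ hloop, hΦ.2.1⟩
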